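/- **Definitions.** Let $\Gamma\subset\mathbb R^d$ be a finitely generated additive subgroup spanning $\mathbb R^d$. A *quantum fan* $(\Delta,v)$ in $\Gamma$ with $n$ one-dimensional cones consists of a collection $\Delta$ of strongly convex cones, each generated by finitely many elements of $\Gamma$, containing $\{0\}$ and all faces of its members and such that any two cones meet in a common face, together with a labelling by $1,\dots,n$ of the one-dimensional cones and a generator $v_i\in\Gamma\setminus\{0\}$ of the $i$-th one. It is *simplicial* if every cone is generated by linearly independent vectors, and *$\Gamma$-complete* if $\Gamma=\mathbb Zv_1+\dots+\mathbb Zv_n$. A *morphism* $(\Delta,v)\to(\Delta',v')$ is a linear map $L$ with $L(\Gamma)\subset\Gamma'$, mapping every cone of $\Delta$ into a cone of $\Delta'$, and such that whenever $L(v_i)\in\sigma'\in\Delta'$, the vector $L(v_i)$ is an $\mathbb N$-linear combination of those $v'_j$ that lie in $\sigma'$. The *combinatorial type* $\mathrm{comb}(\Delta)$ is the set of all $I\subset\{1,\dots,n\}$ such that the cone generated by $(v_i)_{i\in I}$ belongs to $\Delta$; two types are *equivalent* if they differ by a permutation of $\{1,\dots,n\}$. Let $D$ be the combinatorial type of some $\Gamma$-complete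 simplicial quantum fan in $\mathbb R^d$ with $n$ one-dimensional cones (so $n\ge d$). Through the correspondence between simplicial quantum fans and quantum toric stacks, the moduli space $\mathscr M(D,d)$ of $\Gamma$-complete simplicial quantum toric stacks of combinatorial type $D$ is the set of isomorphism classes of $\Gamma$-complete simplicial quantum fans in $\mathbb R^d$ (with varying $\Gamma$) whose combinatorial type is equivalent to $D$. For $D'$ equivalent to $D$, a configuration $u=(v_{d+1},\dots,v_n)\in(\mathbb R^d)^{n-d}$ is *$D'$-realizable* if there is a $\Gamma$-complete simplicial quantum fan with generators $v_1=e_1,\dots,v_d=e_d,v_{d+1},\dots,v_n$ and combinatorial type $D'$ (a *standard* fan); let $U_{D'}$ be the set of these $u$. The space $\mathscr M(D,d)$ carries the quotient topology coming from the Euclidean topology on the configurations of generators of the standard fans of the finitely many types $D'$ equivalent to $D$. A *real orbifold of dimension $k$* is given by a proper étale Lie groupoid of dimension $k$ (its isotropy groups are then finite); its underlying space is the orbit space. **Statement.** 1. For every $D'$ equivalent to $D$, the set $U_{D'}$ is open in $(\mathbb R^d)^{n-d}$. 2. Let $X=\bigsqcup_{D'}U_{D'}$, the union being over all $D'$ equivalent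 to $D$. Let $\mathcal G$ be the groupoid with objects $X$ whose arrows $(D',u)\to(D'',u')$ are the permutations $s\in\mathfrak S_n$ such that the matrix $(v_{s(1)},\dots,v_{s(d)})$ is invertible, its inverse $L$ maps $v_{s(i)}$ to $v'_i$ for all $1\le i\le n$, and $D''=\{I: s(I)\in D'\}$. With the topology on the arrows induced from $X\times X\times\mathfrak S_n$, $\mathcal G$ is a real orbifold of dimension $d(n-d)$; its smooth structure can be chosen so that $(D',u)\mapsto u\in(\mathbb R^d)^{n-d}$ is a local diffeomorphism. 3. Sending $(D',u)$ to the standard fan with these generators and type, and $s$ to the linear map $L$, is an equivalence from $\mathcal G$ to the groupoid of $\Gamma$-complete simplicial quantum fans of type equivalent to $D$ and their isomorphisms. It induces a homeomorphism from the orbit space of $\mathcal G$ to $\mathscr M(D,d)$. Thus $\mathscr M(D,d)$ is the quotient of $X$ by the equivalence relation induced by permutations and the associated linear normalizations, and it is endowed with a structure of real orbifold of dimension $d(n-d)$; all automorphism groups of the fans concerned are finite. 4. If $D'$ is equivalent to $D$ and $\{1,\dots,d\}\in D'$, then the restriction of $X\to X/\mathcal G\cong\mathscr M(D,d)$ to the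 single open set $U_{D'}\subset(\mathbb R^d)^{n-d}$ is already a quotient map onto $\mathscr M(D,d)$. -/

import Mathlib

open CategoryTheory
open scoped Manifold ContDiff

namespace QuantumToric

/-! ### Quantum fans -/

/-- A quantum fan in `ℝ^d` with `n` one-dimensional cones, labelled by `Fin n`: a finitely generated
additive subgroup `Γ` spanning `ℝ^d`, a fan of strongly convex cones generated by elements of `Γ`,
and a generator `gen i ∈ Γ ∖ {0}` for every one-dimensional cone. -/
structure QuantumFan (d n : ℕ) where
  /-- the subgroup in which the fan lives -/
  Γ : AddSubgroup (Fin d → ℝ)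
  fg : Γ.FG
  span_eq_top : Submodule.span ℝ (Γ : Set (Fin d → ℝ)) = ⊤
  /-- the cones of the fan -/
  cones : Set (PointedCone ℝ (Fin d → ℝ))
  generated : ∀ σ ∈ cones, ∃ S : Finset (Fin d → ℝ),
    (S : Set (Fin d → ℝ)) ⊆ Γ ∧ σ = PointedCone.hull ℝ (S : Set (Fin d → ℝ))
  salient : ∀ σ ∈ cones, (σ : ConvexCone ℝ (Fin d → ℝ)).Salient
  bot_mem : ⊥ ∈ cones
  face_mem : ∀ σ ∈ cones, ∀ τ : PointedCone ℝ (Fin d → ℝ), τ.IsFaceOf σ → τ ∈ cones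
  inf_isFaceOf : ∀ σ ∈ cones, ∀ τ ∈ cones, (σ ⊓ τ).IsFaceOf σ
  /-- the chosen generators of the one-dimensional cones -/
  gen : Fin n → Fin d → ℝ
  gen_mem : ∀ i, gen i ∈ Γ
  gen_ne_zero : ∀ i, gen i ≠ 0
  ray_mem : ∀ i, PointedCone.hull ℝ {gen i} ∈ cones
  ray_injective : Function.Injective fun i => PointedCone.hull ℝ {gen i}
  ray_surjective : ∀ σ ∈ cones,
    Module.finrank ℝ (Submodule.span ℝ (σ : Set (Fin d → ℝ))) = 1 →
      ∃ i, σ = PointedCone.hull ℝ {gen i}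

namespace QuantumFan

variable {d n : ℕ}

/-- The fan is `Γ`-complete if `Γ = ℤ v₁ + ⋯ + ℤ vₙ`. -/
def IsGammaComplete (F : QuantumFan d n) : Prop :=
  F.Γ = AddSubgroup.closure (Set.range F.gen)

/-- The fan is simplicial if every cone is a cone over a simplex. -/
def IsSimplicial (F : QuantumFan d n) : Prop :=
  ∀ σ ∈ F.cones, σ.IsSimplicial

/-- The combinatorial type: all sets `I` of labels such that the cone generated by
the `v_i`, `i ∈ I`, belongs to the fan. -/
def comb (F : QuantumFan d n) : Set (Finset (Fin n)) :=
  {I | PointedCone.hull ℝ (F.gen '' (I : Set (Fin n))) ∈ F.cones}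

/-- A morphism of quantum fans. In `map_gen`, the generators lying in the cone `σ'` are those of
the one-dimensional faces of `σ'`. -/
@[ext]
structure Hom (F F' : QuantumFan d n) where
  /-- the underlying linear map -/
  toLin : (Fin d → ℝ) →ₗ[ℝ] (Fin d → ℝ)
  map_Γ : ∀ x ∈ F.Γ, toLin x ∈ F'.Γ
  map_cone : ∀ σ ∈ F.cones, ∃ σ' ∈ F'.cones, ∀ x ∈ σ, toLin x ∈ σ'
  map_gen : ∀ i, ∀ σ' ∈ F'.cones, toLin (F.gen i) ∈ σ' →
    toLin (F.gen i) ∈ AddSubmonoid.closure {w | w ∈ σ' ∧ ∃ j, w = F'.gen j}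

/-- The identity morphism. -/
def Hom.id (F : QuantumFan d n) : Hom F F where
  toLin := LinearMap.id
  map_Γ := fun _ hx => hx
  map_cone := fun σ hσ => ⟨σ, hσ, fun _ hx => hx⟩
  map_gen := fun i _ _ h => AddSubmonoid.subset_closure ⟨h, i, rfl⟩

/-- Composition of morphisms. -/
def Hom.comp {F F' F'' : QuantumFan d n} (f : Hom F F') (g : Hom F' F'') : Hom F F'' where
  toLin := g.toLin.comp f.toLin
  map_Γ := fun x hx => g.map_Γ _ (f.map_Γ x hx)
  map_cone := fun σ hσ => by
    obtain ⟨σ', hσ', h⟩ := f.map_cone σ hσ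
    obtain ⟨σ'', hσ'', h'⟩ := g.map_cone σ' hσ'
    exact ⟨σ'', hσ'', fun x hx => h' _ (h x hx)⟩
  map_gen := fun i σ'' hσ'' hmem => by
    obtain ⟨σ', hσ', h⟩ := f.map_cone _ (F.ray_mem i)
    have hi : f.toLin (F.gen i) ∈ σ' := h _ (PointedCone.subset_hull (Set.mem_singleton _))
    obtain ⟨τ, hτ, h'⟩ := g.map_cone σ' hσ'
    have hle : ∀ x ∈ AddSubmonoid.closure {w | w ∈ σ' ∧ ∃ j, w = F'.gen j}, x ∈ σ' := by
      intro x hx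
      have : AddSubmonoid.closure {w | w ∈ σ' ∧ ∃ j, w = F'.gen j} ≤ σ'.toAddSubmonoid :=
        AddSubmonoid.closure_le.2 fun w hw => hw.1
      exact this hx
    have key : ∀ x ∈ AddSubmonoid.closure {w | w ∈ σ' ∧ ∃ j, w = F'.gen j},
        g.toLin x ∈ σ'' →
          g.toLin x ∈ AddSubmonoid.closure {w | w ∈ σ'' ∧ ∃ j, w = F''.gen j} := by
      intro x hx
      induction hx using AddSubmonoid.closure_induction with
      | mem x hx =>
        obtain ⟨_, j, rfl⟩ := hx
        exact g.map_gen j σ'' hσ''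
      | zero => intro _; rw [map_zero]; exact zero_mem _
      | add x y hx hy ihx ihy =>
        intro hxy
        have hface := F''.inf_isFaceOf τ hτ σ'' hσ''
        have hxτ : g.toLin x ∈ τ := h' _ (hle x hx)
        have hyτ : g.toLin y ∈ τ := h' _ (hle y hy)
        have hsum : g.toLin x + g.toLin y ∈ τ ⊓ σ'' :=
          ⟨add_mem hxτ hyτ, by rw [← map_add]; exact hxy⟩
        have hx' : g.toLin x ∈ τ ⊓ σ'' :=
          hface.mem_of_smul_add_mem hxτ hyτ one_pos (by rw [one_smul]; exact hsum)
        have hy' : g.toLin y ∈ τ ⊓ σ'' :=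
          hface.mem_of_smul_add_mem hyτ hxτ one_pos (by rw [one_smul, add_comm]; exact hsum)
        rw [map_add]
        exact add_mem (ihx hx'.2) (ihy hy'.2)
    exact key _ (f.map_gen i σ' hσ' hi) hmem

/-- The category of quantum fans in `ℝ^d` with `n` one-dimensional cones. -/
instance : Category (QuantumFan d n) where
  Hom := Hom
  id := Hom.id
  comp := Hom.comp

end QuantumFan

/-! ### Combinatorial types and the moduli space -/

section Moduli

variable {d n m : ℕ}

/-- The collection `s⁻¹ · D = {I | s(I) ∈ D}`. -/
def relabel (s : Equiv.Perm (Fin n)) (D : Set (Finset (Fin n))) : Set (Finset (Fin n)) :=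
  {I | I.map s.toEmbedding ∈ D}

/-- `D` and `D'` differ by a permutation of the labels. -/
def CombEquiv (D D' : Set (Finset (Fin n))) : Prop :=
  ∃ s : Equiv.Perm (Fin n), D' = relabel s D

/-- The category of `Γ`-complete simplicial quantum fans in `ℝ^d` whose combinatorial type is
equivalent to `D`. -/
abbrev FanOfType (d : ℕ) (D : Set (Finset (Fin n))) : Type :=
  ObjectProperty.FullSubcategory fun F : QuantumFan d n =>
    F.IsGammaComplete ∧ F.IsSimplicial ∧ CombEquiv D F.comb

/-- The moduli space of `Γ`-complete simplicial quantum fans (equivalently, of the associated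
quantum toric stacks) of combinatorial type `D`: the set of isomorphism classes. -/
def ModuliSpace (d : ℕ) (D : Set (Finset (Fin n))) : Type :=
  Quotient (isIsomorphicSetoid (FanOfType d D))

/-- The isomorphism class of a fan. -/
def ModuliSpace.mk {D : Set (Finset (Fin n))} (F : FanOfType d D) : ModuliSpace d D :=
  Quotient.mk (isIsomorphicSetoid (FanOfType d D)) F

/-- The vectors `e₁, …, e_d, u₁, …, u_m` of `ℝ^d`. -/
def stdGen (u : Fin m → Fin d → ℝ) : Fin (d + m) → Fin d → ℝ :=
  Fin.append (fun i => Pi.single i 1) u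

/-- The standard fans of type `D`: the first `d` generators form the canonical basis. -/
def StdFan (d m : ℕ) (D : Set (Finset (Fin (d + m)))) : Type :=
  {F : FanOfType d D // ∃ u : Fin m → Fin d → ℝ, F.obj.gen = stdGen u}

/-- A standard fan is described by its combinatorial type (a discrete datum) and by its
generators, which vary in a Euclidean space. -/
instance (D : Set (Finset (Fin (d + m)))) : TopologicalSpace (StdFan d m D) :=
  TopologicalSpace.induced (fun F => F.1.obj.comb) ⊥ ⊓
    TopologicalSpace.induced (fun F => F.1.obj.gen) inferInstance

/-- The moduli space carries the quotient topology coming from the Euclidean topology on the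
configurations of generators of standard fans. -/
instance (D : Set (Finset (Fin (d + m)))) : TopologicalSpace (ModuliSpace d D) :=
  TopologicalSpace.coinduced (fun F : StdFan d m D => ModuliSpace.mk F.1) inferInstance

/-- The configuration `u = (v_{d+1}, …, v_{d+m})` is `D`-realizable: there is a standard
(`Γ`-complete, simplicial) fan with generators `e₁, …, e_d, v_{d+1}, …, v_{d+m}` and
combinatorial type `D`. -/
def IsRealizable (D : Set (Finset (Fin (d + m)))) (u : Fin m → Fin d → ℝ) : Prop :=
  ∃ F : QuantumFan d (d + m),
    F.gen = stdGen u ∧ F.IsGammaComplete ∧ F.IsSimplicial ∧ F.comb = D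

/-- The space of configurations: the disjoint union, over all `D'` equivalent to `D`, of
the spaces of `D'`-realizable configurations, with the disjoint union topology. -/
def Config (d m : ℕ) (D : Set (Finset (Fin (d + m)))) : Type :=
  Σ D' : {D' : Set (Finset (Fin (d + m))) // CombEquiv D D'},
    {u : Fin m → Fin d → ℝ // IsRealizable D'.1 u}

instance (D : Set (Finset (Fin (d + m)))) : TopologicalSpace (Config d m D) :=
  inferInstanceAs (TopologicalSpace
    (Σ D' : {D' : Set (Finset (Fin (d + m))) // CombEquiv D D'},
      {u : Fin m → Fin d → ℝ // IsRealizable D'.1 u}))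

namespace Config

variable {D : Set (Finset (Fin (d + m)))}

/-- The configuration `u` in the component of index `D'`. -/
def mk {D' : Set (Finset (Fin (d + m)))} (h : CombEquiv D D')
    (u : {u : Fin m → Fin d → ℝ // IsRealizable D' u}) : Config d m D :=
  ⟨⟨D', h⟩, u⟩

/-- The component in which a configuration lies. -/
def type (x : Config d m D) : Set (Finset (Fin (d + m))) := x.1.1

/-- The vectors `v_{d+1}, …, v_{d+m}` of a configuration. -/
def coord (x : Config d m D) : Fin m → Fin d → ℝ := x.2.1

/-- All vectors `v₁ = e₁, …, v_d = e_d, v_{d+1}, …, v_{d+m}` of a configuration. -/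
def gen (x : Config d m D) : Fin (d + m) → Fin d → ℝ := stdGen x.coord

/-- The matrix with columns `v_{s(1)}, …, v_{s(d)}`. -/
def frame (x : Config d m D) (s : Equiv.Perm (Fin (d + m))) : Matrix (Fin d) (Fin d) ℝ :=
  Matrix.of fun a j => x.gen (s (Fin.castAdd m j)) a

/-- An arrow `x ⟶ y`: a permutation `s` such that the matrix `(v_{s(1)}, …, v_{s(d)})` is
invertible, its inverse `L` sends `v_{s(i)}` to `v'_i` for all `i`, and `s` exchanges the
combinatorial types (so that `L` sends the cones of the first fan to those of the second). -/
@[ext]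
structure Arrow (x y : Config d m D) where
  /-- the permutation -/
  s : Equiv.Perm (Fin (d + m))
  isUnit_det : IsUnit (x.frame s).det
  map_gen : ∀ i, (x.frame s)⁻¹.mulVec (x.gen (s i)) = y.gen i
  type_eq : y.type = relabel s x.type

theorem gen_castAdd (x : Config d m D) (j : Fin d) :
    x.gen (Fin.castAdd m j) = Pi.single j 1 := by
  simp [gen, stdGen, Fin.append_left]

theorem frame_one (x : Config d m D) : x.frame 1 = 1 := by
  ext a j
  simp [frame, gen_castAdd, Matrix.one_apply, Pi.single_apply]

theorem Arrow.frame_mul {x y : Config d m D} (f : Arrow x y) (t : Equiv.Perm (Fin (d + m))) :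
    y.frame t = (x.frame f.s)⁻¹ * x.frame (f.s * t) := by
  ext a j
  simp only [frame, Matrix.of_apply, ← f.map_gen]
  rfl

theorem relabel_one (D' : Set (Finset (Fin n))) : relabel 1 D' = D' := by
  ext I
  have h : (1 : Equiv.Perm (Fin n)).toEmbedding = Function.Embedding.refl _ := rfl
  simp [relabel, h]

theorem relabel_mul (s t : Equiv.Perm (Fin n)) (D' : Set (Finset (Fin n))) :
    relabel (s * t) D' = relabel t (relabel s D') := by
  ext I
  change I.map (s * t).toEmbedding ∈ D' ↔ (I.map t.toEmbedding).map s.toEmbedding ∈ D'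
  rw [Finset.map_map]
  rfl

/-- The identity arrow. -/
def Arrow.id (x : Config d m D) : Arrow x x where
  s := 1
  isUnit_det := by simp [frame_one]
  map_gen := fun i => by simp [frame_one]
  type_eq := (relabel_one _).symm

theorem Arrow.frame_mul' {x y : Config d m D} (f : Arrow x y) (t : Equiv.Perm (Fin (d + m))) :
    x.frame f.s * y.frame t = x.frame (f.s * t) := by
  rw [f.frame_mul, Matrix.mul_nonsing_inv_cancel_left _ _ f.isUnit_det]

/-- Composition of arrows. -/
def Arrow.comp {x y z : Config d m D} (f : Arrow x y) (g : Arrow y z) : Arrow x z where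
  s := f.s * g.s
  isUnit_det := by
    rw [← f.frame_mul', Matrix.det_mul]
    exact f.isUnit_det.mul g.isUnit_det
  map_gen := fun i => by
    rw [← f.frame_mul', Matrix.mul_inv_rev, ← Matrix.mulVec_mulVec, Equiv.Perm.mul_apply,
      f.map_gen, g.map_gen]
  type_eq := by rw [g.type_eq, f.type_eq, relabel_mul]

/-- The inverse arrow. -/
def Arrow.inv {x y : Config d m D} (f : Arrow x y) : Arrow y x :=
  have h : x.frame f.s * y.frame f.s⁻¹ = 1 := by
    rw [f.frame_mul', mul_inv_cancel, frame_one]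
  { s := f.s⁻¹
    isUnit_det := (Matrix.isUnit_iff_isUnit_det _).1 (IsUnit.of_mul_eq_one_right _ h)
    map_gen := fun i => by
      rw [Matrix.inv_eq_left_inv h, ← f.map_gen, Matrix.mulVec_mulVec,
        Matrix.mul_nonsing_inv _ f.isUnit_det, Matrix.one_mulVec]
      exact congrArg x.gen (f.s.apply_symm_apply i)
    type_eq := by rw [f.type_eq, ← relabel_mul, mul_inv_cancel, relabel_one] }

/-- The groupoid of configurations and normalizations. -/
instance : Groupoid.{0} (Config d m D) where
  Hom := Arrow
  id := Arrow.id
  comp := Arrow.comp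
  inv := Arrow.inv
  id_comp f := Arrow.ext (one_mul f.s)
  comp_id f := Arrow.ext (mul_one f.s)
  assoc f g h := Arrow.ext (mul_assoc f.s g.s h.s)
  inv_comp f := Arrow.ext (inv_mul_cancel f.s)
  comp_inv f := Arrow.ext (mul_inv_cancel f.s)

/-- The permutation underlying an arrow. -/
def perm {x y : Config d m D} (f : x ⟶ y) : Equiv.Perm (Fin (d + m)) := Arrow.s f

/-- The space of all arrows `(x, y, s)`, topologized as a subspace of the product of two copies of
the space of configurations and of the discrete space of permutations. -/
instance : TopologicalSpace (Quiver.Total (Config d m D)) :=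
  TopologicalSpace.induced (fun a => (a.left, a.right)) inferInstance ⊓
    TopologicalSpace.induced (fun a => perm a.hom) ⊥

end Config

end Moduli

/-! ### Real orbifolds -/

section Orbifold

variable (X : Type) [Groupoid.{0} X]

/-- The isomorphism classes of objects of a groupoid. -/
def OrbitSpace : Type := Quotient (isIsomorphicSetoid X)

variable {X} in
/-- The class of an object. -/
def OrbitSpace.mk (x : X) : OrbitSpace X := Quotient.mk (isIsomorphicSetoid X) x

/-- The orbit space carries the quotient topology. -/
instance [TopologicalSpace X] : TopologicalSpace (OrbitSpace X) :=
  TopologicalSpace.coinduced OrbitSpace.mk inferInstance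

variable [TopologicalSpace X] [TopologicalSpace (Quiver.Total X)]

/-- The structure of a real orbifold of dimension `k` on a topological groupoid: it is
a proper étale Lie groupoid of dimension `k`, i.e. objects and arrows form smooth Hausdorff
second countable `k`-manifolds, source and target are local diffeomorphisms, the other structure
maps are smooth, and `(source, target)` is proper. Since the source map is a local diffeomorphism
compatible with composition, smoothness of the composition is the same as its continuity. -/
structure RealOrbifold (k : ℕ) where
  [chartedObj : ChartedSpace (EuclideanSpace ℝ (Fin k)) X]
  [isManifoldObj : IsManifold (𝓡 k) ∞ X]
  [t2Obj : T2Space X]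
  [secondCountableObj : SecondCountableTopology X]
  [chartedArr : ChartedSpace (EuclideanSpace ℝ (Fin k)) (Quiver.Total X)]
  [isManifoldArr : IsManifold (𝓡 k) ∞ (Quiver.Total X)]
  [t2Arr : T2Space (Quiver.Total X)]
  [secondCountableArr : SecondCountableTopology (Quiver.Total X)]
  source_localDiffeo : IsLocalDiffeomorph (𝓡 k) (𝓡 k) ∞ fun a : Quiver.Total X => a.left
  target_localDiffeo : IsLocalDiffeomorph (𝓡 k) (𝓡 k) ∞ fun a : Quiver.Total X => a.right
  unit_smooth : ContMDiff (𝓡 k) (𝓡 k) ∞ fun x : X => (⟨x, x, 𝟙 x⟩ : Quiver.Total X)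
  inv_smooth : ContMDiff (𝓡 k) (𝓡 k) ∞ fun a : Quiver.Total X =>
    (⟨a.right, a.left, Groupoid.inv a.hom⟩ : Quiver.Total X)
  comp_continuous : Continuous
    fun q : {q : Quiver.Total X × Quiver.Total X // q.1.right = q.2.left} =>
      (⟨q.1.1.left, q.1.2.right, q.1.1.hom ≫ eqToHom q.2 ≫ q.1.2.hom⟩ : Quiver.Total X)
  proper : IsProperMap fun a : Quiver.Total X => (a.left, a.right)

end Orbifold

end QuantumToric

/-! A standard simplicial fan is determined by its combinatorial type `D'` and its vectors `u`. The
type must be an abstract simplicial complex. The only condition on the vectors is `IsFanConfig`: a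
point common to the cones over `I` and `J` has the same coefficients in both. Equivalently, no
nonzero `w` in the closed cone `signCone I J` gives a relation `∑ w i • v i = 0`. By homogeneity it
is enough to test unit vectors `w`, which form a compact set, so the condition is open in the
vectors (`isRealizable_iff`, `isOpen_isFanConfig`).

Isomorphisms of fans are rigid: they permute the generators (`iso_exists_perm`), because integrality
in both directions excludes proper multiples. Any `d` independent generators can be moved to the
canonical basis by a unique linear map, so every fan is isomorphic to a standard one, and
isomorphisms of standard fans are exactly the permutations followed by normalization. This yields
the equivalence of groupoids.

For a fixed permutation, the arrows form the graph of the rational map `normCoord` over the open set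
where a determinant is nonzero, so the groupoid is étale. The arrows also form a closed subset of `X
× X × 𝔖` with `𝔖` finite, so it is proper. The orbit map is therefore open, which gives the quotient
statement for a single component once that component is seen to meet every orbit. -/

namespace QuantumToric

/-! ### Cones over simplices -/

section Cones

variable {ι E : Type*}

/-- The coefficients of the relations that express that a point of the cone over `I` is also
a point of the cone over `J`, up to a combination of the vectors with label in `I ∩ J`. -/
def signCone (I J : Finset ι) : Set (ι → ℝ) :=
  {w | (∀ i ∉ J, 0 ≤ w i) ∧ ∀ i ∉ I, w i ≤ 0}

variable [Fintype ι] [AddCommGroup E] [Module ℝ E]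

/-- Coefficients are extended by zero to all labels, so that combinations over different simplices
can be subtracted. -/
theorem mem_hull_image_iff {v : ι → E} {I : Finset ι} {x : E} :
    x ∈ PointedCone.hull ℝ (v '' (I : Set ι)) ↔
      ∃ c : ι → ℝ, (∀ i, 0 ≤ c i) ∧ (∀ i ∉ I, c i = 0) ∧ ∑ i, c i • v i = x := by
  classical
  constructor
  · intro hx
    induction hx using Submodule.span_induction with
    | mem x hx =>
      obtain ⟨i, hi, rfl⟩ := hx
      refine ⟨Pi.single i 1, fun j => ?_, fun j hj => ?_, ?_⟩
      · rw [Pi.single_apply]; split_ifs <;> norm_num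
      · rw [Pi.single_apply, if_neg]; rintro rfl; exact hj hi
      · simp [Pi.single_apply, ite_smul]
    | zero => exact ⟨0, by simp, by simp, by simp⟩
    | add x y _ _ hx hy =>
      obtain ⟨a, ha, ha', rfl⟩ := hx
      obtain ⟨b, hb, hb', rfl⟩ := hy
      refine ⟨a + b, fun i => add_nonneg (ha i) (hb i), fun i hi => ?_, ?_⟩
      · simp [ha' i hi, hb' i hi]
      · simp [add_smul, Finset.sum_add_distrib]
    | smul r x _ hx =>
      obtain ⟨a, ha, ha', rfl⟩ := hx
      refine ⟨fun i => r.1 * a i, fun i => mul_nonneg r.2 (ha i), fun i hi => ?_, ?_⟩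
      · simp [ha' i hi]
      · simp only [Finset.smul_sum, mul_smul]; rfl
  · rintro ⟨c, hc, hc', rfl⟩
    refine Submodule.sum_mem _ fun i _ => ?_
    by_cases hi : i ∈ I
    · exact Submodule.smul_mem _ (⟨c i, hc i⟩ : {c : ℝ // 0 ≤ c})
        (Submodule.subset_span ⟨i, hi, rfl⟩)
    · rw [hc' i hi, zero_smul]; exact Submodule.zero_mem _

theorem mem_hull_singleton_iff {a x : E} :
    x ∈ PointedCone.hull ℝ {a} ↔ ∃ r : ℝ, 0 ≤ r ∧ r • a = x := by
  rw [Submodule.mem_span_singleton]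
  exact ⟨fun ⟨r, h⟩ => ⟨r.1, r.2, h⟩, fun ⟨r, hr, h⟩ => ⟨⟨r, hr⟩, h⟩⟩

theorem hull_singleton_smul {a : E} {r : ℝ} (hr : 0 < r) :
    PointedCone.hull ℝ {r • a} = PointedCone.hull ℝ {a} := by
  apply le_antisymm
  · rw [Submodule.span_singleton_le_iff_mem, mem_hull_singleton_iff]
    exact ⟨r, hr.le, rfl⟩
  · rw [Submodule.span_singleton_le_iff_mem, mem_hull_singleton_iff]
    exact ⟨r⁻¹, (inv_pos.2 hr).le, by rw [smul_smul, inv_mul_cancel₀ hr.ne', one_smul]⟩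

theorem hull_singleton_eq_of_mem {a x : E} (hx : x ≠ 0) (h : x ∈ PointedCone.hull ℝ {a}) :
    PointedCone.hull ℝ {x} = PointedCone.hull ℝ {a} := by
  obtain ⟨r, hr, rfl⟩ := mem_hull_singleton_iff.1 h
  refine hull_singleton_smul (lt_of_le_of_ne hr ?_)
  rintro rfl
  simp at hx

theorem span_hull (s : Set E) :
    Submodule.span ℝ (PointedCone.hull ℝ s : Set E) = Submodule.span ℝ s := by
  apply le_antisymm
  · exact Submodule.span_le.2 (PointedCone.hull_le_span ℝ s)
  · exact Submodule.span_mono Submodule.subset_span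

/-- The cones over the simplices of `D` with vertices `v i` are simplicial, and two of them meet in
the cone over the intersection of the simplices. -/
def IsFanConfig (D : Set (Finset ι)) (v : ι → E) : Prop :=
  ∀ I ∈ D, ∀ J ∈ D, ∀ w ∈ signCone I J, ∑ i, w i • v i = 0 → w = 0

/-- An abstract simplicial complex with vertex set `ι`, the empty simplex included. -/
structure IsComplex (D : Set (Finset ι)) : Prop where
  empty_mem : ∅ ∈ D
  singleton_mem : ∀ i, {i} ∈ D
  mem_of_subset : ∀ J ∈ D, ∀ I, I ⊆ J → I ∈ D

/-- The cones over the simplices of `D`. -/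
def coneFamily (D : Set (Finset ι)) (v : ι → E) : Set (PointedCone ℝ E) :=
  {σ | ∃ I ∈ D, σ = PointedCone.hull ℝ (v '' (I : Set ι))}

variable {D : Set (Finset ι)} {v : ι → E}

/-- The difference `a - b` lies in `signCone I J`. This is the form in which the configuration
condition is mostly used. -/
theorem IsFanConfig.coeff_eq (h : IsFanConfig D v) {I J : Finset ι} (hI : I ∈ D) (hJ : J ∈ D)
    {a b : ι → ℝ} (ha : ∀ i, 0 ≤ a i) (ha' : ∀ i ∉ I, a i = 0) (hb : ∀ i, 0 ≤ b i)
    (hb' : ∀ i ∉ J, b i = 0) (hab : ∑ i, a i • v i = ∑ i, b i • v i) : a = b := by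
  refine sub_eq_zero.1 (h I hI J hJ (a - b) ⟨fun i hi => ?_, fun i hi => ?_⟩ ?_)
  · simp [hb' i hi, ha i]
  · simp [ha' i hi, hb i]
  · simp [sub_smul, hab]

/-- For `J = I` the sign conditions only say that `w` vanishes outside `I`, so what remains is
linear independence. -/
theorem IsFanConfig.eq_zero_of_sum (h : IsFanConfig D v) {I : Finset ι} (hI : I ∈ D)
    {w : ι → ℝ} (hw : ∀ i ∉ I, w i = 0) (hs : ∑ i, w i • v i = 0) : w = 0 :=
  h I hI I hI w ⟨fun i hi => (hw i hi).ge, fun i hi => (hw i hi).le⟩ hs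

theorem IsFanConfig.linearIndepOn (h : IsFanConfig D v) {I : Finset ι} (hI : I ∈ D) :
    LinearIndepOn ℝ v (I : Set ι) := by
  classical
  rw [linearIndepOn_finset_iff]
  intro f hf i hi
  have := h.eq_zero_of_sum hI (w := fun i => if i ∈ I then f i else 0)
    (fun i hi => if_neg hi) (by simpa [ite_smul, Finset.sum_ite_mem] using hf)
  simpa [hi] using congrFun this i

theorem IsFanConfig.mem_of_mem_hull [DecidableEq ι] (h : IsFanConfig D v) (hD : IsComplex D)
    {J : Finset ι} (hJ : J ∈ D) {i : ι}
    (hi : v i ∈ PointedCone.hull ℝ (v '' (J : Set ι))) : i ∈ J := by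
  obtain ⟨c, hc, hc', hs⟩ := mem_hull_image_iff.1 hi
  by_contra hiJ
  have := h.coeff_eq (hD.singleton_mem i) hJ (a := Pi.single i 1) (b := c)
    (fun j => by rw [Pi.single_apply]; split_ifs <;> norm_num)
    (fun j hj => by rw [Pi.single_apply, if_neg]; simpa using hj) hc hc'
    (by rw [hs]; simp [Pi.single_apply, ite_smul])
  simpa [hc' i hiJ] using congrFun this i

theorem IsFanConfig.subset_of_hull_le (h : IsFanConfig D v) (hD : IsComplex D)
    {I J : Finset ι} (hJ : J ∈ D)
    (hIJ : PointedCone.hull ℝ (v '' (I : Set ι)) ≤ PointedCone.hull ℝ (v '' (J : Set ι))) :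
    I ⊆ J := by
  classical
  exact fun i hi => h.mem_of_mem_hull hD hJ (hIJ (Submodule.subset_span ⟨i, hi, rfl⟩))

/-- If `x + y` uses only labels in `I`, uniqueness of coefficients over `J` makes the nonnegative
coefficients of `x` and `y` cancel outside `I`, hence vanish there. -/
theorem IsFanConfig.isFaceOf (h : IsFanConfig D v) {I J : Finset ι} (hJ : J ∈ D) (hIJ : I ⊆ J) :
    (PointedCone.hull ℝ (v '' (I : Set ι))).IsFaceOf (PointedCone.hull ℝ (v '' (J : Set ι))) := by
  refine .of_mem_of_add_mem_left (Submodule.span_mono (Set.image_mono hIJ)) fun {x y} hx hy hxy => ?_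
  obtain ⟨a, ha, ha', rfl⟩ := mem_hull_image_iff.1 hx
  obtain ⟨b, hb, hb', rfl⟩ := mem_hull_image_iff.1 hy
  obtain ⟨c, hc, hc', hs⟩ := mem_hull_image_iff.1 hxy
  have key : a + b = c := h.coeff_eq hJ hJ (fun i => add_nonneg (ha i) (hb i))
    (fun i hi => by simp [ha' i hi, hb' i hi]) hc (fun i hi => hc' i fun hi' => hi (hIJ hi'))
    (by rw [hs]; simp [add_smul, Finset.sum_add_distrib])
  refine mem_hull_image_iff.2 ⟨a, ha, fun i hi => ?_, rfl⟩
  have h0 : a i + b i = 0 := by simpa [hc' i hi] using congrFun key i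
  linarith [ha i, hb i]

theorem IsFanConfig.hull_inf_hull [DecidableEq ι] (h : IsFanConfig D v) {I J : Finset ι}
    (hI : I ∈ D) (hJ : J ∈ D) :
    PointedCone.hull ℝ (v '' (I : Set ι)) ⊓ PointedCone.hull ℝ (v '' (J : Set ι)) =
      PointedCone.hull ℝ (v '' ((I ∩ J : Finset ι) : Set ι)) := by
  apply le_antisymm
  · rintro x ⟨hx, hy⟩
    obtain ⟨a, ha, ha', rfl⟩ := mem_hull_image_iff.1 hx
    obtain ⟨b, hb, hb', hs⟩ := mem_hull_image_iff.1 hy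
    obtain rfl := h.coeff_eq hI hJ ha ha' hb hb' hs.symm
    refine mem_hull_image_iff.2 ⟨a, ha, fun i hi => ?_, rfl⟩
    by_cases hiI : i ∈ I
    · exact hb' i fun hiJ => hi (Finset.mem_inter.2 ⟨hiI, hiJ⟩)
    · exact ha' i hiI
  · exact le_inf (Submodule.span_mono (Set.image_mono (by simp)))
      (Submodule.span_mono (Set.image_mono (by simp)))

/-- Every face of the cone generated by finitely many vectors is generated by some of them. -/
theorem eq_hull_of_isFaceOf {J : Finset ι} {τ : PointedCone ℝ E}
    (hτ : τ.IsFaceOf (PointedCone.hull ℝ (v '' (J : Set ι)))) :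
    ∃ I ⊆ J, τ = PointedCone.hull ℝ (v '' (I : Set ι)) := by
  classical
  refine ⟨J.filter fun i => v i ∈ τ, Finset.filter_subset _ _, le_antisymm (fun x hx => ?_) ?_⟩
  · obtain ⟨a, ha, ha', rfl⟩ := mem_hull_image_iff.1 (hτ.le hx)
    have hmem : ∀ i, a i ≠ 0 → v i ∈ τ := by
      intro i hi
      have hiJ : i ∈ J := by by_contra hiJ; exact hi (ha' i hiJ)
      -- Isolating one term with positive coefficient lets the face property put `v i` itself into
      -- `τ`.
      rw [← Finset.add_sum_erase _ _ (Finset.mem_univ i)] at hx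
      refine hτ.mem_of_smul_add_mem (Submodule.subset_span ⟨i, hiJ, rfl⟩) ?_
        (lt_of_le_of_ne (ha i) hi.symm) hx
      refine mem_hull_image_iff.2 ⟨fun j => if j = i then 0 else a j, fun j => ?_, fun j hj => ?_, ?_⟩
      · dsimp only; split_ifs <;> [exact le_rfl; exact ha j]
      · simp [ha' j hj]
      · simp [ite_smul, Finset.sum_ite, Finset.filter_ne']
    refine mem_hull_image_iff.2 ⟨a, ha, fun i hi => ?_, rfl⟩
    by_contra h0
    exact hi (Finset.mem_filter.2 ⟨by by_contra hiJ; exact h0 (ha' i hiJ), hmem i h0⟩)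
  · rw [Submodule.span_le]
    rintro _ ⟨i, hi, rfl⟩
    exact (Finset.mem_filter.1 hi).2

theorem IsFanConfig.ne_zero (h : IsFanConfig D v) (hD : IsComplex D) (i : ι) : v i ≠ 0 := by
  intro h0
  have := (h.linearIndepOn (hD.singleton_mem i)).ne_zero (Finset.mem_coe.2 (Finset.mem_singleton_self i))
  exact this h0

theorem IsFanConfig.salient (h : IsFanConfig D v) {I : Finset ι} (hI : I ∈ D) :
    ((PointedCone.hull ℝ (v '' (I : Set ι)) : PointedCone ℝ E) : ConvexCone ℝ E).Salient := by
  intro x hx hx0 hnx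
  obtain ⟨a, ha, ha', rfl⟩ := mem_hull_image_iff.1 hx
  obtain ⟨b, hb, hb', hs⟩ := mem_hull_image_iff.1 hnx
  have key := h.eq_zero_of_sum hI (w := a + b) (fun i hi => by simp [ha' i hi, hb' i hi])
    (by simp [add_smul, Finset.sum_add_distrib, hs])
  refine hx0 (Finset.sum_eq_zero fun i _ => ?_)
  have h0 : a i + b i = 0 := congrFun key i
  have : a i = 0 := by linarith [ha i, hb i]
  simp [this]

theorem IsFanConfig.isSimplicial (h : IsFanConfig D v) {I : Finset ι} (hI : I ∈ D) :
    (PointedCone.hull ℝ (v '' (I : Set ι))).IsSimplicial :=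
  ⟨v '' I, I.finite_toSet.image v, (h.linearIndepOn hI).id_image, rfl⟩

theorem IsFanConfig.finrank (h : IsFanConfig D v) {I : Finset ι} (hI : I ∈ D) :
    Module.finrank ℝ (Submodule.span ℝ
      (PointedCone.hull ℝ (v '' (I : Set ι)) : Set E)) = I.card := by
  have := finrank_span_eq_card (h.linearIndepOn hI)
  rw [span_hull, Set.image_eq_range]
  simpa using this

end Cones

/-! ### Simplicial fans and fan configurations -/

variable {d n : ℕ}

/-- The `Γ`-complete simplicial fan of a fan configuration. -/
def fanOfConfig {D : Set (Finset (Fin n))} {v : Fin n → Fin d → ℝ} (hD : IsComplex D)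
    (h : IsFanConfig D v) (hv : Submodule.span ℝ (Set.range v) = ⊤) : QuantumFan d n where
  Γ := AddSubgroup.closure (Set.range v)
  fg := ⟨(Set.finite_range v).toFinset, by simp⟩
  span_eq_top := top_le_iff.1 (hv ▸ Submodule.span_mono AddSubgroup.subset_closure)
  cones := coneFamily D v
  generated := by
    rintro _ ⟨I, -, rfl⟩
    classical
    refine ⟨I.image v, ?_, by simp⟩
    rintro _ hx
    obtain ⟨i, -, rfl⟩ := Finset.mem_image.1 (Finset.mem_coe.1 hx)
    exact AddSubgroup.subset_closure ⟨i, rfl⟩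
  salient := by
    rintro _ ⟨I, hI, rfl⟩
    exact h.salient hI
  bot_mem := ⟨∅, hD.empty_mem, by simp⟩
  face_mem := by
    rintro _ ⟨J, hJ, rfl⟩ τ hτ
    obtain ⟨I, hIJ, rfl⟩ := eq_hull_of_isFaceOf hτ
    exact ⟨I, hD.mem_of_subset J hJ I hIJ, rfl⟩
  inf_isFaceOf := by
    rintro _ ⟨I, hI, rfl⟩ _ ⟨J, hJ, rfl⟩
    rw [h.hull_inf_hull hI hJ]
    exact h.isFaceOf hI Finset.inter_subset_left
  gen := v
  gen_mem := fun i => AddSubgroup.subset_closure ⟨i, rfl⟩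
  gen_ne_zero := h.ne_zero hD
  ray_mem := fun i => ⟨{i}, hD.singleton_mem i, by simp⟩
  ray_injective := fun i j hij => by
    have := h.subset_of_hull_le hD (hD.singleton_mem j) (I := {i}) (by simpa using le_of_eq hij)
    simpa using this
  ray_surjective := by
    rintro _ ⟨I, hI, rfl⟩ h1
    rw [h.finrank hI] at h1
    obtain ⟨i, rfl⟩ := Finset.card_eq_one.1 h1
    exact ⟨i, by simp⟩

section

variable {D : Set (Finset (Fin n))} {v : Fin n → Fin d → ℝ} (hD : IsComplex D)
    (h : IsFanConfig D v) (hv : Submodule.span ℝ (Set.range v) = ⊤)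

theorem fanOfConfig_isGammaComplete : (fanOfConfig hD h hv).IsGammaComplete := rfl

theorem fanOfConfig_isSimplicial : (fanOfConfig hD h hv).IsSimplicial := by
  rintro _ ⟨I, hI, rfl⟩
  exact h.isSimplicial hI

theorem fanOfConfig_comb : (fanOfConfig hD h hv).comb = D := by
  ext I
  refine ⟨?_, fun hI => ⟨I, hI, rfl⟩⟩
  rintro ⟨J, hJ, hIJ⟩
  exact hD.mem_of_subset J hJ I (h.subset_of_hull_le hD hJ (le_of_eq hIJ))

end

/-! ### From a simplicial fan to its configuration of generators. -/

namespace QuantumFan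

variable (F : QuantumFan d n)

theorem hull_isFaceOf {σ τ : PointedCone ℝ (Fin d → ℝ)} (hσ : σ ∈ F.cones) (hτ : τ ∈ F.cones)
    (h : τ ≤ σ) : τ.IsFaceOf σ := by
  have := F.inf_isFaceOf σ hσ τ hτ
  rwa [inf_eq_right.2 h] at this

theorem ray_isFaceOf {σ : PointedCone ℝ (Fin d → ℝ)} (hσ : σ ∈ F.cones) {i : Fin n}
    (hi : F.gen i ∈ σ) : (PointedCone.hull ℝ {F.gen i}).IsFaceOf σ :=
  F.hull_isFaceOf hσ (F.ray_mem i) ((Submodule.span_singleton_le_iff_mem _ _).2 hi)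

theorem eq_of_gen_mem_hull {i j : Fin n} (h : F.gen j ∈ PointedCone.hull ℝ {F.gen i}) : j = i :=
  F.ray_injective (hull_singleton_eq_of_mem (F.gen_ne_zero j) h)

theorem gen_injective : Function.Injective F.gen := fun _ _ hij =>
  F.ray_injective (congrArg (fun x => PointedCone.hull ℝ {x}) hij)

/-- The ray of `gen i` is a face of the cone, hence generated by some of the `gen j` with `j ∈ J`.
Such a `gen j` lies on that ray, and distinct labels have distinct rays. -/
theorem mem_of_gen_mem_hull {J : Finset (Fin n)} (hJ : J ∈ F.comb) {i : Fin n}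
    (hi : F.gen i ∈ PointedCone.hull ℝ (F.gen '' (J : Set (Fin n)))) : i ∈ J := by
  obtain ⟨I, hIJ, hI⟩ := eq_hull_of_isFaceOf (F.ray_isFaceOf hJ hi)
  obtain ⟨j, hj⟩ : I.Nonempty := by
    by_contra! h0
    subst h0
    have hmem : F.gen i ∈ PointedCone.hull ℝ {F.gen i} := Submodule.mem_span_singleton_self _
    rw [hI] at hmem
    exact F.gen_ne_zero i (by simpa using hmem)
  have : F.gen j ∈ PointedCone.hull ℝ {F.gen i} := by
    rw [hI]
    exact Submodule.subset_span ⟨j, hj, rfl⟩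
  exact F.eq_of_gen_mem_hull this ▸ hIJ hj

theorem comb_isComplex_of_linearIndepOn
    (h : ∀ J ∈ F.comb, LinearIndepOn ℝ F.gen (J : Set (Fin n))) : IsComplex F.comb where
  empty_mem := by simpa [comb] using F.bot_mem
  singleton_mem := fun i => by simpa [comb] using F.ray_mem i
  mem_of_subset := fun J hJ I hIJ => by
    -- Linear independence makes the one-element family `{J}` a fan configuration, so every subset
    -- of `J` spans a face.
    refine F.face_mem _ hJ _ (IsFanConfig.isFaceOf (D := {J}) ?_ rfl hIJ)
    rintro A (hA : A = J) B (hB : B = J) w hw hs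
    subst hA hB
    have h0 : ∀ i ∉ B, w i = 0 := fun i hi => le_antisymm (hw.2 i hi) (hw.1 i hi)
    have hs' : ∑ i ∈ B, w i • F.gen i = 0 := by
      rw [← hs]
      exact Finset.sum_subset (Finset.subset_univ _) fun i _ hi => by rw [h0 i hi, zero_smul]
    funext i
    by_cases hi : i ∈ B
    · exact linearIndepOn_finset_iff.1 (h B hJ) w hs' i hi
    · exact h0 i hi

variable {F}

/-- A cone of a simplicial fan is generated by linearly independent generators of the fan. -/
theorem IsSimplicial.exists_eq_hull (hF : F.IsSimplicial) {σ : PointedCone ℝ (Fin d → ℝ)}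
    (hσ : σ ∈ F.cones) : ∃ J : Finset (Fin n), σ = PointedCone.hull ℝ (F.gen '' (J : Set (Fin n))) ∧
      LinearIndepOn ℝ F.gen (J : Set (Fin n)) := by
  classical
  obtain ⟨S, hSf, hS, rfl⟩ := hF σ hσ
  lift S to Finset (Fin d → ℝ) using hSf
  have hcfg : IsFanConfig {(Finset.univ : Finset S)} (Subtype.val : S → Fin d → ℝ) := by
    rintro _ rfl _ rfl w - hw
    exact funext (Fintype.linearIndependent_iff.1 hS w hw)
  -- Each `s` spans a face of `σ`, hence a one-dimensional cone of the fan, whose chosen generator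
  -- is a positive multiple of `s`.
  have hray : ∀ s : S, ∃ i, ∃ r : ℝ, 0 < r ∧ F.gen i = r • (s : Fin d → ℝ) := by
    intro s
    have hface := hcfg.isFaceOf rfl (Finset.subset_univ {s})
    have hs0 : (s : Fin d → ℝ) ≠ 0 := LinearIndependent.ne_zero s hS
    have hmem : PointedCone.hull ℝ {(s : Fin d → ℝ)} ∈ F.cones := by
      refine F.face_mem _ hσ _ ?_
      simpa using hface
    obtain ⟨i, hi⟩ := F.ray_surjective _ hmem (by rw [span_hull]; exact finrank_span_singleton hs0)
    have : F.gen i ∈ PointedCone.hull ℝ {(s : Fin d → ℝ)} := by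
      rw [hi]; exact Submodule.mem_span_singleton_self _
    obtain ⟨r, hr, hri⟩ := mem_hull_singleton_iff.1 this
    refine ⟨i, r, lt_of_le_of_ne hr ?_, hri.symm⟩
    rintro rfl
    exact F.gen_ne_zero i (by simpa using hri.symm)
  choose φ r hr hφ using hray
  have hφi : Function.Injective φ := by
    intro s t hst
    have h1 := hφ s
    rw [hst, hφ t] at h1
    by_contra hne
    -- If `s` and `t` shared a label, `r t • t = r s • s` would be a nontrivial relation in `S`.
    have := hcfg.eq_zero_of_sum rfl (w := Pi.single t (r t) - Pi.single s (r s))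
      (fun i hi => absurd (Finset.mem_univ i) hi)
      (by simp [sub_smul, Pi.single_apply, ite_smul, h1])
    have h2 := congrFun this t
    simp [Ne.symm hne, (hr t).ne'] at h2
  refine ⟨Finset.univ.image φ, le_antisymm ?_ ?_, ?_⟩
  · rw [Submodule.span_le]
    intro s hs
    have : s = (r ⟨s, hs⟩)⁻¹ • F.gen (φ ⟨s, hs⟩) := by
      rw [hφ, smul_smul, inv_mul_cancel₀ (hr _).ne', one_smul]
    rw [this]
    exact Submodule.smul_mem _ (⟨(r ⟨s, hs⟩)⁻¹, (inv_pos.2 (hr _)).le⟩ : {c : ℝ // 0 ≤ c})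
      (Submodule.subset_span ⟨φ ⟨s, hs⟩, by simp, rfl⟩)
  · rw [Submodule.span_le]
    rintro _ ⟨i, hi, rfl⟩
    obtain ⟨s, -, rfl⟩ := Finset.mem_image.1 (Finset.mem_coe.1 hi)
    rw [hφ]
    exact Submodule.smul_mem _ (⟨r s, (hr s).le⟩ : {c : ℝ // 0 ≤ c}) (Submodule.subset_span s.2)
  · rw [Finset.coe_image, Finset.coe_univ, Set.image_univ]
    refine (linearIndependent_equiv (Equiv.ofInjective φ hφi)).1 ?_
    have h2 : LinearIndependent ℝ fun s : S => (Units.mk0 (r s) (hr s).ne') • (s : Fin d → ℝ) :=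
      LinearIndependent.units_smul hS _
    convert h2 using 2 with s
    exact hφ s

/-- A priori the generators labelled by `J` could be redundant. An independent `I` generating the
same cone must contain every label of `J`, by `mem_of_gen_mem_hull`. -/
theorem IsSimplicial.linearIndepOn (hF : F.IsSimplicial) {J : Finset (Fin n)} (hJ : J ∈ F.comb) :
    LinearIndepOn ℝ F.gen (J : Set (Fin n)) := by
  obtain ⟨I, hI, hli⟩ := hF.exists_eq_hull hJ
  have hI' : I ∈ F.comb := by
    change _ ∈ F.cones
    rw [← hI]
    exact hJ
  refine hli.mono fun j hj => F.mem_of_gen_mem_hull hI' ?_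
  rw [← hI]
  exact Submodule.subset_span ⟨j, hj, rfl⟩

theorem IsSimplicial.isComplex (hF : F.IsSimplicial) : IsComplex F.comb :=
  F.comb_isComplex_of_linearIndepOn fun _ hJ => hF.linearIndepOn hJ

theorem IsSimplicial.cones_eq (hF : F.IsSimplicial) : F.cones = coneFamily F.comb F.gen := by
  ext σ
  constructor
  · intro hσ
    obtain ⟨J, rfl, -⟩ := hF.exists_eq_hull hσ
    exact ⟨J, hσ, rfl⟩
  · rintro ⟨I, hI, rfl⟩
    exact hI

/-- Moving the negative terms of a relation to the other side produces a point common to the cones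
over `I` and `J`. The intersection is a face, so a label outside `J` with positive coefficient would
have its generator in the cone over `J`, which is impossible. The relation is then supported on `J`
and independence finishes. -/
theorem IsSimplicial.isFanConfig (hF : F.IsSimplicial) : IsFanConfig F.comb F.gen := by
  classical
  have aux : ∀ I ∈ F.comb, ∀ J ∈ F.comb, ∀ w ∈ signCone I J, ∑ i, w i • F.gen i = 0 →
      ∀ i, i ∉ J → w i ≤ 0 := by
    intro I hI J hJ w hw hs i hiJ
    by_contra! hpos
    have hiI : i ∈ I := by by_contra hiI; exact absurd (hw.2 i hiI) (not_le.2 hpos)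
    have hsum : ∑ i, (w i)⁺ • F.gen i = ∑ i, (w i)⁻ • F.gen i := by
      rw [← sub_eq_zero, ← Finset.sum_sub_distrib, ← hs]
      exact Finset.sum_congr rfl fun i _ => by rw [← sub_smul, posPart_sub_negPart]
    have hp : ∑ i, (w i)⁺ • F.gen i ∈ PointedCone.hull ℝ (F.gen '' (I : Set (Fin n))) :=
      mem_hull_image_iff.2 ⟨_, fun i => posPart_nonneg _,
        fun i hi => posPart_eq_zero.2 (hw.2 i hi), rfl⟩
    have hq : ∑ i, (w i)⁺ • F.gen i ∈ PointedCone.hull ℝ (F.gen '' (J : Set (Fin n))) := by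
      rw [hsum]
      exact mem_hull_image_iff.2 ⟨_, fun i => negPart_nonneg _,
        fun i hi => negPart_eq_zero.2 (hw.1 i hi), rfl⟩
    have hface := F.inf_isFaceOf _ hI _ hJ
    have hτ : ∑ i, (w i)⁺ • F.gen i ∈ PointedCone.hull ℝ (F.gen '' (I : Set (Fin n))) ⊓
        PointedCone.hull ℝ (F.gen '' (J : Set (Fin n))) := ⟨hp, hq⟩
    rw [← Finset.add_sum_erase _ _ (Finset.mem_univ i)] at hτ
    have hmem := hface.mem_of_smul_add_mem (Submodule.subset_span ⟨i, hiI, rfl⟩) ?_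
      (posPart_pos hpos) hτ
    · exact hiJ (F.mem_of_gen_mem_hull hJ hmem.2)
    · refine Submodule.sum_mem _ fun j _ => ?_
      by_cases hj : j ∈ I
      · exact Submodule.smul_mem _ (⟨(w j)⁺, posPart_nonneg _⟩ : {c : ℝ // 0 ≤ c})
          (Submodule.subset_span ⟨j, hj, rfl⟩)
      · rw [posPart_eq_zero.2 (hw.2 j hj), zero_smul]
        exact Submodule.zero_mem _
  intro I hI J hJ w hw hs
  have h1 : ∀ i, i ∉ J → w i = 0 := fun i hi => le_antisymm (aux I hI J hJ w hw hs i hi) (hw.1 i hi)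
  funext i
  by_cases hi : i ∈ J
  · refine linearIndepOn_finset_iff.1 (hF.linearIndepOn hJ) w ?_ i hi
    rw [← hs]
    exact Finset.sum_subset (Finset.subset_univ _) fun i _ hi => by rw [h1 i hi, zero_smul]
  · exact h1 i hi

end QuantumFan

/-! ### Realizable configurations -/

section Realizable

open Filter Topology

variable {ι E : Type*}

theorem isClosed_signCone (I J : Finset ι) : IsClosed (signCone I J) := by
  simp only [signCone, Set.ofPred_and, Set.ofPred_forall]
  refine IsClosed.inter ?_ ?_
  · exact isClosed_iInter fun i => isClosed_iInter fun _ =>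
      isClosed_le continuous_const (continuous_apply i)
  · exact isClosed_iInter fun i => isClosed_iInter fun _ =>
      isClosed_le (continuous_apply i) continuous_const

theorem smul_mem_signCone {I J : Finset ι} {w : ι → ℝ} (hw : w ∈ signCone I J) {r : ℝ}
    (hr : 0 ≤ r) : r • w ∈ signCone I J :=
  ⟨fun i hi => mul_nonneg hr (hw.1 i hi), fun i hi => mul_nonpos_of_nonneg_of_nonpos hr (hw.2 i hi)⟩

variable [Fintype ι] [NormedAddCommGroup E] [NormedSpace ℝ E]

/-- Fan configurations form an open set. -/
theorem isOpen_isFanConfig (D : Set (Finset ι)) : IsOpen {v : ι → E | IsFanConfig D v} := by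
  -- Both the relation and `signCone` are invariant under positive scaling, so only `w` of norm one
  -- matters.
  have hD : {v : ι → E | IsFanConfig D v} = ⋂ I ∈ D, ⋂ J ∈ D,
      {v | ∀ w ∈ signCone I J ∩ Metric.sphere 0 1, ∑ i, w i • v i ≠ 0} := by
    ext v
    simp only [Set.mem_iInter, Set.mem_ofPred_eq]
    refine ⟨fun h I hI J hJ w hw h0 => ?_, fun h I hI J hJ w hw h0 => ?_⟩
    · have := hw.2
      rw [h I hI J hJ w hw.1 h0] at this
      simp at this
    · by_contra hne
      have hpos : 0 < ‖w‖ := norm_pos_iff.2 hne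
      refine h I hI J hJ (‖w‖⁻¹ • w) ⟨smul_mem_signCone hw (inv_nonneg.2 hpos.le), ?_⟩ ?_
      · simp [norm_smul, inv_mul_cancel₀ hpos.ne']
      · simp only [Pi.smul_apply, smul_eq_mul, mul_smul, ← Finset.smul_sum, h0, smul_zero]
  rw [hD]
  refine D.toFinite.isOpen_biInter fun I _ => D.toFinite.isOpen_biInter fun J _ => ?_
  refine isOpen_iff_eventually.2 fun v hv => ?_
  -- Nonvanishing of a jointly continuous function along a compact set persists for nearby `v`.
  refine ((isCompact_sphere (0 : ι → ℝ) 1).inter_left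
    (isClosed_signCone I J)).eventually_forall_of_forall_eventually fun w hw => ?_
  have hc : Continuous fun z : (ι → E) × (ι → ℝ) => ∑ i, z.2 i • z.1 i := by fun_prop
  exact hc.continuousAt.eventually_ne (hv w hw)

end Realizable

variable {d m n : ℕ}

theorem stdGen_castAdd (u : Fin m → Fin d → ℝ) (j : Fin d) :
    stdGen u (Fin.castAdd m j) = Pi.single j 1 := by
  simp [stdGen, Fin.append_left]

theorem stdGen_natAdd (u : Fin m → Fin d → ℝ) (j : Fin m) :
    stdGen u (Fin.natAdd d j) = u j := by
  simp [stdGen, Fin.append_right]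

theorem stdGen_injective : Function.Injective (stdGen : (Fin m → Fin d → ℝ) → _) := by
  intro u u' h
  funext j
  rw [← stdGen_natAdd u, h, stdGen_natAdd]

theorem contDiff_stdGen : ContDiff ℝ ∞ (stdGen : (Fin m → Fin d → ℝ) → _) := by
  refine contDiff_pi.2 fun i => ?_
  induction i using Fin.addCases with
  | left j => simpa only [stdGen_castAdd] using contDiff_const
  | right j => simpa only [stdGen_natAdd] using contDiff_apply ℝ (Fin d → ℝ) j

theorem span_range_stdGen (u : Fin m → Fin d → ℝ) :
    Submodule.span ℝ (Set.range (stdGen u)) = ⊤ := by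
  rw [eq_top_iff, ← (Pi.basisFun ℝ (Fin d)).span_eq, Submodule.span_le]
  rintro _ ⟨j, rfl⟩
  refine Submodule.subset_span ⟨Fin.castAdd m j, ?_⟩
  rw [stdGen_castAdd, Pi.basisFun_apply]

/-- Realizability splits into a condition on `D` alone and an open condition on `u`. The spanning
condition is automatic because the canonical basis is among the vectors. -/
theorem isRealizable_iff {D : Set (Finset (Fin (d + m)))} {u : Fin m → Fin d → ℝ} :
    IsRealizable D u ↔ IsComplex D ∧ IsFanConfig D (stdGen u) := by
  constructor
  · rintro ⟨F, hu, -, hF, rfl⟩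
    exact ⟨hF.isComplex, hu ▸ hF.isFanConfig⟩
  · rintro ⟨hD, h⟩
    exact ⟨fanOfConfig hD h (span_range_stdGen u), rfl, fanOfConfig_isGammaComplete hD h _,
      fanOfConfig_isSimplicial hD h _, fanOfConfig_comb hD h _⟩

theorem isOpen_isRealizable (D : Set (Finset (Fin (d + m)))) :
    IsOpen {u : Fin m → Fin d → ℝ | IsRealizable D u} := by
  simp only [isRealizable_iff]
  by_cases hD : IsComplex D
  · simp only [hD, true_and]
    exact (isOpen_isFanConfig D).preimage contDiff_stdGen.continuous
  · simp [hD]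

theorem IsComplex.relabel {D : Set (Finset (Fin n))} (hD : IsComplex D) (s : Equiv.Perm (Fin n)) :
    IsComplex (relabel s D) where
  empty_mem := by simpa [QuantumToric.relabel] using hD.empty_mem
  singleton_mem := fun i => by simpa [QuantumToric.relabel] using hD.singleton_mem (s i)
  mem_of_subset := fun _ hJ _ hIJ => hD.mem_of_subset _ hJ _ (Finset.map_subset_map.2 hIJ)

/-- By injectivity of `L`, a relation `w` among the `v' i` is a relation `w ∘ s⁻¹` among the `v i`,
and the sign conditions are transported by `s`. -/
theorem IsFanConfig.relabel {D : Set (Finset (Fin n))} {v v' : Fin n → Fin d → ℝ}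
    (h : IsFanConfig D v) (s : Equiv.Perm (Fin n)) (L : (Fin d → ℝ) →ₗ[ℝ] Fin d → ℝ)
    (hL : Function.Injective L) (hv : ∀ i, L (v (s i)) = v' i) : IsFanConfig (relabel s D) v' := by
  intro I hI J hJ w hw h0
  have key := h _ hI _ hJ (w ∘ s.symm) ⟨fun i hi => hw.1 _ fun h' => hi ?_,
    fun i hi => hw.2 _ fun h' => hi ?_⟩ ?_
  · funext i
    simpa using congrFun key (s i)
  · exact Finset.mem_map.2 ⟨_, h', by simp⟩
  · exact Finset.mem_map.2 ⟨_, h', by simp⟩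
  · apply hL
    rw [map_zero, ← h0, map_sum, ← Equiv.sum_comp s]
    simp [hv]

theorem CombEquiv.relabel {D D' : Set (Finset (Fin n))} (h : CombEquiv D D')
    (s : Equiv.Perm (Fin n)) : CombEquiv D (relabel s D') := by
  obtain ⟨t, rfl⟩ := h
  exact ⟨t * s, (Config.relabel_mul t s D).symm⟩

namespace Config

variable {D : Set (Finset (Fin (d + m)))}

theorem ext_type_coord {x y : Config d m D} (ht : x.type = y.type) (hc : x.coord = y.coord) :
    x = y := by
  obtain ⟨⟨D₁, h₁⟩, u₁, hu₁⟩ := x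
  obtain ⟨⟨D₂, h₂⟩, u₂, hu₂⟩ := y
  obtain rfl : D₁ = D₂ := ht
  obtain rfl : u₁ = u₂ := hc
  rfl

theorem isComplex (x : Config d m D) : IsComplex x.type := (isRealizable_iff.1 x.2.2).1

theorem isFanConfig (x : Config d m D) : IsFanConfig x.type x.gen := (isRealizable_iff.1 x.2.2).2

theorem gen_injective (x : Config d m D) : Function.Injective x.gen := by
  intro i j hij
  classical
  have : x.gen i ∈ PointedCone.hull ℝ (x.gen '' (({j} : Finset _) : Set (Fin (d + m)))) := by
    rw [hij]
    exact Submodule.subset_span ⟨j, by simp, rfl⟩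
  simpa using x.isFanConfig.mem_of_mem_hull x.isComplex (x.isComplex.singleton_mem j) this

theorem span_range_gen (x : Config d m D) : Submodule.span ℝ (Set.range x.gen) = ⊤ :=
  span_range_stdGen _

/-! ### Normalization of a configuration by a permutation. -/

section Normalize

/-- The matrix with columns `v_{s(1)}, …, v_{s(d)}` as a function of `v_{d+1}, …, v_{d+m}`. -/
def stdFrame (s : Equiv.Perm (Fin (d + m))) (u : Fin m → Fin d → ℝ) : Matrix (Fin d) (Fin d) ℝ :=
  Matrix.of fun a j => stdGen u (s (Fin.castAdd m j)) a

/-- The coordinates of the configuration `L v_{s(1)}, …, L v_{s(d+m)}`, where `L` is the inverse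
of the matrix `(v_{s(1)}, …, v_{s(d)})`. -/
noncomputable def normCoord (s : Equiv.Perm (Fin (d + m))) (u : Fin m → Fin d → ℝ) :
    Fin m → Fin d → ℝ :=
  fun i => (stdFrame s u)⁻¹.mulVec (stdGen u (s (Fin.natAdd d i)))

theorem frame_mulVec_single (x : Config d m D) (s : Equiv.Perm (Fin (d + m))) (j : Fin d) :
    (x.frame s).mulVec (Pi.single j 1) = x.gen (s (Fin.castAdd m j)) := by
  rw [Matrix.mulVec_single_one]
  rfl

/-- The first `d` normalized vectors are the canonical basis, since the inverse of a matrix sends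
its columns there. The result is thus again standard. -/
theorem stdGen_normCoord (x : Config d m D) {s : Equiv.Perm (Fin (d + m))}
    (h : IsUnit (x.frame s).det) (i : Fin (d + m)) :
    (x.frame s)⁻¹.mulVec (x.gen (s i)) = stdGen (normCoord s x.coord) i := by
  induction i using Fin.addCases with
  | left j =>
    rw [stdGen_castAdd, ← frame_mulVec_single, Matrix.mulVec_mulVec,
      Matrix.nonsing_inv_mul _ h, Matrix.one_mulVec]
  | right j => rw [stdGen_natAdd]; rfl

theorem mulVecLin_inv_injective (x : Config d m D) {s : Equiv.Perm (Fin (d + m))}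
    (h : IsUnit (x.frame s).det) : Function.Injective (Matrix.mulVecLin (x.frame s)⁻¹) := by
  refine Function.LeftInverse.injective (g := (x.frame s).mulVec) fun v => ?_
  rw [Matrix.mulVecLin_apply, Matrix.mulVec_mulVec, Matrix.mul_nonsing_inv _ h, Matrix.one_mulVec]

/-- The target of the arrow with source `x` and permutation `s`. -/
noncomputable def normalize (x : Config d m D) (s : Equiv.Perm (Fin (d + m)))
    (h : IsUnit (x.frame s).det) : Config d m D :=
  mk (CombEquiv.relabel x.1.2 s) ⟨normCoord s x.coord, isRealizable_iff.2
    ⟨x.isComplex.relabel s, x.isFanConfig.relabel s _ (x.mulVecLin_inv_injective h)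
      (x.stdGen_normCoord h)⟩⟩

/-- The arrow with source `x` and permutation `s`. -/
noncomputable def normalizeArrow (x : Config d m D) (s : Equiv.Perm (Fin (d + m)))
    (h : IsUnit (x.frame s).det) : x ⟶ x.normalize s h :=
  (⟨s, h, x.stdGen_normCoord h, rfl⟩ : Arrow x (x.normalize s h))

theorem coord_eq_normCoord {x y : Config d m D} (f : x ⟶ y) :
    y.coord = normCoord (perm f) x.coord := by
  apply stdGen_injective
  funext i
  exact (Arrow.map_gen f i).symm.trans (x.stdGen_normCoord (Arrow.isUnit_det f) i)

/-- Consequently the arrows with a given permutation form the graph of a map on the set where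
`frame` is invertible. -/
theorem eq_normalize {x y : Config d m D} (f : x ⟶ y) :
    y = x.normalize (perm f) (Arrow.isUnit_det f) :=
  ext_type_coord (Arrow.type_eq f) (coord_eq_normCoord f)

theorem perm_injective {x y : Config d m D} : Function.Injective (perm : (x ⟶ y) → _) :=
  fun _ _ h => Arrow.ext h

/-- An arrow is determined by its source and its permutation. -/
theorem total_ext {a b : Quiver.Total (Config d m D)} (h : a.left = b.left)
    (hp : perm a.hom = perm b.hom) : a = b := by
  obtain ⟨x, y, f⟩ := a
  obtain ⟨x', y', g⟩ := b
  obtain rfl : x = x' := h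
  obtain rfl : y = y' := by
    rw [eq_normalize f, eq_normalize g]
    congr 1
  obtain rfl : f = g := perm_injective hp
  rfl

theorem contDiff_stdFrame_det (s : Equiv.Perm (Fin (d + m))) :
    ContDiff ℝ ∞ fun u => (stdFrame (d := d) (m := m) s u).det := by
  have h : ∀ i a, ContDiff ℝ ∞ fun u : Fin m → Fin d → ℝ => stdGen u i a := fun i a =>
    contDiff_pi.1 (contDiff_pi.1 contDiff_stdGen i) a
  simp only [Matrix.det_apply, stdFrame, Matrix.of_apply]
  exact ContDiff.sum fun σ _ => (contDiff_prod fun i _ => h _ _).const_smul _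

theorem contDiffAt_normCoord (s : Equiv.Perm (Fin (d + m))) {u : Fin m → Fin d → ℝ}
    (hu : IsUnit (stdFrame s u).det) : ContDiffAt ℝ ∞ (normCoord s) u := by
  have h : ∀ i a, ContDiff ℝ ∞ fun u : Fin m → Fin d → ℝ => stdGen u i a := fun i a =>
    contDiff_pi.1 (contDiff_pi.1 contDiff_stdGen i) a
  -- Cramer's rule: the inverse is the adjugate, polynomial in `u`, divided by the determinant.
  have hadj : ∀ i j, ContDiff ℝ ∞ fun u : Fin m → Fin d → ℝ => (stdFrame s u).adjugate i j := by
    intro i j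
    simp only [Matrix.adjugate_apply, Matrix.det_apply]
    refine ContDiff.sum fun σ _ => (contDiff_prod fun k _ => ?_).const_smul _
    by_cases hk : σ k = j
    · simp only [Matrix.updateRow_apply, hk, if_true]
      exact contDiff_const
    · simp only [Matrix.updateRow_apply, hk, if_false, stdFrame, Matrix.of_apply]
      exact h _ _
  refine contDiffAt_pi.2 fun i => contDiffAt_pi.2 fun a => ?_
  simp only [normCoord, Matrix.mulVec, dotProduct, Matrix.inv_def, Ring.inverse_eq_inv',
    Matrix.smul_apply, smul_eq_mul]
  exact ContDiffAt.sum fun j _ =>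
    (((contDiff_stdFrame_det s).contDiffAt.inv hu.ne_zero).mul (hadj a j).contDiffAt).mul
      (h _ j).contDiffAt

end Normalize

end Config

/-! ### Smooth structures defined by local homeomorphisms -/

section LocalHomeo

open Topology

variable {E M : Type*} [NormedAddCommGroup E] [NormedSpace ℝ E] [TopologicalSpace M] {f : M → E}

/-- The charted space structure whose charts are all local inverses of a local homeomorphism. -/
noncomputable abbrev chartedSpaceOfLocalHomeomorph (hf : IsLocalHomeomorph f) :
    ChartedSpace E M where
  atlas := {e | ⇑e = f}
  chartAt x := (hf x).choose
  mem_chart_source x := (hf x).choose_spec.1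
  chart_mem_atlas x := (hf x).choose_spec.2.symm

/-- All charts are the same function `f` with different sources, so every transition map is the
identity on its domain. -/
theorem isManifold_of_localHomeomorph (hf : IsLocalHomeomorph f) :
    letI := chartedSpaceOfLocalHomeomorph hf
    IsManifold 𝓘(ℝ, E) ∞ M := by
  let := chartedSpaceOfLocalHomeomorph hf
  refine isManifold_of_contDiffOn 𝓘(ℝ, E) ∞ M fun e e' (he : ⇑e = f) (he' : ⇑e' = f) => ?_
  refine contDiffOn_id.congr fun y hy => ?_
  have hy' : y ∈ e.target := by
    have := hy.1
    simp only [modelWithCornersSelf_coe_symm, Set.preimage_id, OpenPartialHomeomorph.trans_source,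
      OpenPartialHomeomorph.symm_source] at this
    exact this.1
  have : e' (e.symm y) = y := by rw [he', ← he, e.right_inv hy']
  simpa using this

theorem isLocalDiffeomorph_of_localHomeomorph (hf : IsLocalHomeomorph f) :
    letI := chartedSpaceOfLocalHomeomorph hf
    IsLocalDiffeomorph 𝓘(ℝ, E) 𝓘(ℝ, E) ∞ f := by
  let := chartedSpaceOfLocalHomeomorph hf
  have := isManifold_of_localHomeomorph hf
  intro x
  obtain ⟨e, hx, he⟩ := hf x
  have hmem : e ∈ IsManifold.maximalAtlas 𝓘(ℝ, E) ∞ M :=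
    IsManifold.subset_maximalAtlas (show ⇑e = f from he.symm)
  refine ⟨⟨e.toPartialEquiv, e.open_source, e.open_target, contMDiffOn_of_mem_maximalAtlas hmem,
    contMDiffOn_symm_of_mem_maximalAtlas hmem⟩, hx, fun y _ => congrFun he y⟩

end LocalHomeo

/-! ### Lifting smoothness along local diffeomorphisms. -/

section LocalDiffeo

variable {E₁ E₂ E₃ M N P : Type*}
  [NormedAddCommGroup E₁] [NormedSpace ℝ E₁] [NormedAddCommGroup E₂] [NormedSpace ℝ E₂]
  [NormedAddCommGroup E₃] [NormedSpace ℝ E₃]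
  [TopologicalSpace M] [ChartedSpace E₁ M] [TopologicalSpace N] [ChartedSpace E₂ N]
  [TopologicalSpace P] [ChartedSpace E₃ P] {p : N → P} {g : M → N} {n : WithTop ℕ∞}

/-- A continuous lift of a smooth map along a local diffeomorphism is smooth. -/
theorem IsLocalDiffeomorph.contMDiffAt_of_comp
    (hp : IsLocalDiffeomorph 𝓘(ℝ, E₂) 𝓘(ℝ, E₃) n p) {x : M} (hg : ContinuousAt g x)
    (h : ContMDiffAt 𝓘(ℝ, E₁) 𝓘(ℝ, E₃) n (p ∘ g) x) :
    ContMDiffAt 𝓘(ℝ, E₁) 𝓘(ℝ, E₂) n g x := by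
  have hl := (hp (g x)).localInverse_contMDiffAt
  refine (ContMDiffAt.comp (g := (hp (g x)).localInverse) (f := p ∘ g) x hl h).congr_of_eventuallyEq ?_
  exact (hg.eventually (hp (g x)).localInverse_eventuallyEq_left).mono fun y hy => hy.symm

theorem IsLocalDiffeomorph.contMDiff_of_comp
    (hp : IsLocalDiffeomorph 𝓘(ℝ, E₂) 𝓘(ℝ, E₃) n p) (hg : Continuous g)
    (h : ContMDiff 𝓘(ℝ, E₁) 𝓘(ℝ, E₃) n (p ∘ g)) : ContMDiff 𝓘(ℝ, E₁) 𝓘(ℝ, E₂) n g :=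
  fun x => IsLocalDiffeomorph.contMDiffAt_of_comp hp hg.continuousAt (h x)

/-- A lift of a local diffeomorphism along a local diffeomorphism is a local diffeomorphism as soon
as it is a local homeomorphism. -/
theorem IsLocalDiffeomorph.of_comp
    (hp : IsLocalDiffeomorph 𝓘(ℝ, E₂) 𝓘(ℝ, E₃) n p) (hg : IsLocalHomeomorph g)
    (h : IsLocalDiffeomorph 𝓘(ℝ, E₁) 𝓘(ℝ, E₃) n (p ∘ g)) :
    IsLocalDiffeomorph 𝓘(ℝ, E₁) 𝓘(ℝ, E₂) n g := by
  intro x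
  obtain ⟨e, hx, rfl⟩ := hg x
  refine ⟨⟨e.toPartialEquiv, e.open_source, e.open_target,
    (IsLocalDiffeomorph.contMDiff_of_comp hp hg.continuous h.contMDiff).contMDiffOn,
    fun y hy => ContMDiffAt.contMDiffWithinAt ?_⟩, hx, fun _ _ => rfl⟩
  -- The local inverse of `g` is a continuous lift of `p` along the local diffeomorphism `p ∘ g`.
  refine IsLocalDiffeomorph.contMDiffAt_of_comp h (e.continuousAt_symm hy) ?_
  refine (hp y).contMDiffAt.congr_of_eventuallyEq ?_
  filter_upwards [e.open_target.mem_nhds hy] with z hz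
  exact congrArg p (e.right_inv hz)

end LocalDiffeo

/-! ### The topology of the groupoid of configurations -/

namespace Config

open Filter Topology

variable {d m : ℕ} {D : Set (Finset (Fin (d + m)))}

theorem isOpenEmbedding_mk {D' : Set (Finset (Fin (d + m)))} (h : CombEquiv D D') :
    IsOpenEmbedding (mk h : {u : Fin m → Fin d → ℝ // IsRealizable D' u} → Config d m D) :=
  IsOpenEmbedding.sigmaMk (σ := fun D' : {D' : Set (Finset (Fin (d + m))) // CombEquiv D D'} =>
    {u : Fin m → Fin d → ℝ // IsRealizable D'.1 u}) (i := ⟨D', h⟩)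

theorem range_mk {D' : Set (Finset (Fin (d + m)))} (h : CombEquiv D D') :
    Set.range (mk h) = {y : Config d m D | y.type = D'} := by
  ext y
  constructor
  · rintro ⟨u, rfl⟩
    rfl
  · intro (hy : type y = D')
    subst hy
    exact ⟨y.2, rfl⟩

/-- This separates the topology of the disjoint union into a Euclidean part and a discrete part, and
reduces continuity to `coord` and `type`. -/
theorem nhds_eq (x : Config d m D) :
    𝓝 x = comap coord (𝓝 x.coord) ⊓ 𝓟 {y | y.type = x.type} := by
  have h2 : (Subtype.val : {u // IsRealizable x.type u} → _) =
    (coord : Config d m D → _) ∘ mk x.1.2 := rfl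
  have h1 : 𝓝 x = map (mk x.1.2) (𝓝 x.2) := ((isOpenEmbedding_mk x.1.2).map_nhds_eq x.2).symm
  have h3 : 𝓝 x.2 = comap (mk x.1.2) (comap coord (𝓝 x.coord)) := by
    rw [comap_comap, ← h2]
    exact nhds_induced _ x.2
  rw [h1, h3, map_comap, range_mk]
  rfl

theorem continuous_coord : Continuous (coord : Config d m D → _) :=
  continuous_iff_continuousAt.2 fun x => by
    rw [ContinuousAt, nhds_eq]
    exact tendsto_comap.mono_left inf_le_left

theorem isLocallyConstant_type : IsLocallyConstant (type : Config d m D → _) :=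
  (IsLocallyConstant.iff_eventually_eq _).2 fun x => by
    rw [nhds_eq]
    exact mem_inf_of_right (mem_principal_self _)

theorem continuous_of_coord_type {Z : Type*} [TopologicalSpace Z] {f : Z → Config d m D}
    (hc : Continuous fun z => (f z).coord) (ht : IsLocallyConstant fun z => (f z).type) :
    Continuous f :=
  continuous_iff_continuousAt.2 fun z => by
    rw [ContinuousAt, nhds_eq]
    exact tendsto_inf.2 ⟨tendsto_comap_iff.2 hc.continuousAt,
      tendsto_principal.2 (ht.eventually_eq z)⟩

/-- Openness of realizability enters the orbifold structure here: without it `coord` would only be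
locally an embedding. -/
theorem isOpenMap_coord : IsOpenMap (coord : Config d m D → _) :=
  isOpenMap_sigma.2 fun D' => (isOpen_isRealizable D'.1).isOpenEmbedding_subtypeVal.isOpenMap

theorem isLocalHomeomorph_coord : IsLocalHomeomorph (coord : Config d m D → _) := by
  rw [isLocalHomeomorph_iff_isOpenEmbedding_restrict]
  intro x
  have ho : IsOpen {y : Config d m D | y.type = x.type} := isLocallyConstant_type.isOpen_fiber _
  refine ⟨_, ho.mem_nhds rfl, .of_continuous_injective_isOpenMap
    (continuous_coord.comp continuous_subtype_val) ?_ ?_⟩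
  · intro a b hab
    exact Subtype.ext (ext_type_coord (a.2.trans b.2.symm) hab)
  · exact isOpenMap_coord.comp ho.isOpenEmbedding_subtypeVal.isOpenMap

instance : T2Space (Config d m D) :=
  inferInstanceAs (T2Space (Σ D' : {D' : Set (Finset (Fin (d + m))) // CombEquiv D D'},
      {u : Fin m → Fin d → ℝ // IsRealizable D'.1 u}))

instance : SecondCountableTopology (Config d m D) :=
  inferInstanceAs (SecondCountableTopology
    (Σ D' : {D' : Set (Finset (Fin (d + m))) // CombEquiv D D'},
      {u : Fin m → Fin d → ℝ // IsRealizable D'.1 u}))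

theorem total_topology_eq : (inferInstance : TopologicalSpace (Quiver.Total (Config d m D))) =
    TopologicalSpace.induced (fun a => (a.left, a.right)) inferInstance ⊓
      TopologicalSpace.induced (fun a => perm a.hom) ⊥ := rfl

theorem continuous_left : Continuous fun a : Quiver.Total (Config d m D) => a.left :=
  continuous_fst.comp (f := fun a : Quiver.Total (Config d m D) => (a.left, a.right))
    (continuous_iff_le_induced.2 (total_topology_eq.trans_le inf_le_left))

theorem continuous_right : Continuous fun a : Quiver.Total (Config d m D) => a.right :=
  continuous_snd.comp (f := fun a : Quiver.Total (Config d m D) => (a.left, a.right))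
    (continuous_iff_le_induced.2 (total_topology_eq.trans_le inf_le_left))

theorem isLocallyConstant_perm :
    IsLocallyConstant fun a : Quiver.Total (Config d m D) => perm a.hom := by
  let : TopologicalSpace (Equiv.Perm (Fin (d + m))) := ⊥
  have : DiscreteTopology (Equiv.Perm (Fin (d + m))) := ⟨rfl⟩
  have h : Continuous fun a : Quiver.Total (Config d m D) => perm a.hom :=
    continuous_iff_le_induced.2 (total_topology_eq.trans_le inf_le_right)
  exact (IsLocallyConstant.iff_continuous _).2 h

theorem continuous_total {Z : Type*} [TopologicalSpace Z] {f : Z → Quiver.Total (Config d m D)}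
    (hl : Continuous fun z => (f z).left) (hr : Continuous fun z => (f z).right)
    (hp : IsLocallyConstant fun z => perm (f z).hom) : Continuous f := by
  let : TopologicalSpace (Equiv.Perm (Fin (d + m))) := ⊥
  exact continuous_inf_rng.2 ⟨continuous_induced_rng.2 (hl.prodMk hr),
    continuous_induced_rng.2 hp.continuous⟩

theorem isOpen_isUnit_det (s : Equiv.Perm (Fin (d + m))) :
    IsOpen {x : Config d m D | IsUnit (x.frame s).det} := by
  simp only [isUnit_iff_ne_zero]
  exact isOpen_ne_fun ((contDiff_stdFrame_det s).continuous.comp continuous_coord) continuous_const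

theorem continuous_normalizeArrow (s : Equiv.Perm (Fin (d + m))) :
    Continuous fun x : {x : Config d m D // IsUnit (x.frame s).det} =>
      (⟨x.1, x.1.normalize s x.2, x.1.normalizeArrow s x.2⟩ : Quiver.Total (Config d m D)) := by
  refine continuous_total continuous_subtype_val (continuous_of_coord_type ?_ ?_)
    (IsLocallyConstant.const s)
  · refine continuous_iff_continuousAt.2 fun x => ?_
    exact ContinuousAt.comp (f := fun x : {x : Config d m D // IsUnit (x.frame s).det} => x.1.coord)
      (contDiffAt_normCoord s x.2).continuousAt
      (continuous_coord.comp continuous_subtype_val).continuousAt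
  · exact (isLocallyConstant_type.comp_continuous continuous_subtype_val).comp (relabel s)

theorem isLocalHomeomorph_left :
    IsLocalHomeomorph fun a : Quiver.Total (Config d m D) => a.left := by
  rw [isLocalHomeomorph_iff_isOpenEmbedding_restrict]
  intro a
  have ho := isLocallyConstant_perm.isOpen_fiber (X := Quiver.Total (Config d m D)) (perm a.hom)
  refine ⟨_, ho.mem_nhds rfl, .of_continuous_injective_isOpenMap
    (continuous_left.comp continuous_subtype_val) ?_ ?_⟩
  · intro b c hbc
    exact Subtype.ext (total_ext hbc (b.2.trans c.2.symm))
  · intro V hV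
    have hV' := ho.isOpenEmbedding_subtypeVal.isOpenMap V hV
    -- Over arrows with a fixed permutation, `normalizeArrow` is a continuous section of the source
    -- map, so the image of `V` is a preimage under that section.
    convert (isOpen_isUnit_det (perm a.hom)).isOpenEmbedding_subtypeVal.isOpenMap _
      (hV'.preimage (continuous_normalizeArrow (D := D) (perm a.hom))) using 1
    ext x
    constructor
    · rintro ⟨b, hb, rfl⟩
      have hs : perm b.1.hom = perm a.hom := b.2
      have hu : IsUnit (b.1.left.frame (perm b.1.hom)).det := Arrow.isUnit_det b.1.hom
      rw [hs] at hu
      refine ⟨⟨b.1.left, hu⟩, ⟨b, hb, ?_⟩, rfl⟩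
      exact total_ext rfl hs
    · rintro ⟨⟨y, hy⟩, ⟨b, hb, hby⟩, rfl⟩
      refine ⟨b, hb, ?_⟩
      exact congrArg Quiver.Total.left hby

end Config

/-! ### The groupoid of configurations as an orbifold -/

namespace Config

open Filter Topology

variable {d m : ℕ} {D : Set (Finset (Fin (d + m)))}

theorem perm_comp {x y z : Config d m D} (f : x ⟶ y) (g : y ⟶ z) :
    perm (f ≫ g) = perm f * perm g := rfl

theorem perm_eqToHom {x y : Config d m D} (h : x = y) : perm (eqToHom h) = 1 := by
  subst h
  rfl

/-- The arrows between two configurations in terms of a closed condition. -/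
theorem exists_hom_iff (x y : Config d m D) (s : Equiv.Perm (Fin (d + m))) :
    (∃ f : x ⟶ y, perm f = s) ↔
      (∀ i, (x.frame s).mulVec (y.gen i) = x.gen (s i)) ∧ y.type = relabel s x.type := by
  constructor
  · rintro ⟨f, rfl⟩
    refine ⟨fun i => ?_, Arrow.type_eq f⟩
    have h : IsUnit (x.frame (perm f)).det := Arrow.isUnit_det f
    have hi : (x.frame (perm f))⁻¹.mulVec (x.gen (perm f i)) = y.gen i := Arrow.map_gen f i
    rw [← hi, Matrix.mulVec_mulVec, Matrix.mul_nonsing_inv _ h, Matrix.one_mulVec]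
  · rintro ⟨h, ht⟩
    -- Invertibility need not be imposed separately: the image of `x.frame s` contains all
    -- generators of `x`, which span. This is why limits of arrows remain arrows.
    have hsurj : Function.Surjective (x.frame s).mulVec := by
      change Function.Surjective (Matrix.mulVecLin (x.frame s))
      rw [← LinearMap.range_eq_top, eq_top_iff, ← x.span_range_gen, Submodule.span_le]
      rintro _ ⟨i, rfl⟩
      exact ⟨y.gen (s.symm i), by simp [h]⟩
    have hdet : IsUnit (x.frame s).det :=
      (Matrix.isUnit_iff_isUnit_det _).1 (Matrix.mulVec_surjective_iff_isUnit.1 hsurj)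
    refine ⟨(⟨s, hdet, fun i => ?_, ht⟩ : Arrow x y), rfl⟩
    rw [← h, Matrix.mulVec_mulVec, Matrix.nonsing_inv_mul _ hdet, Matrix.one_mulVec]

theorem continuous_gen (i : Fin (d + m)) : Continuous fun x : Config d m D => x.gen i :=
  (continuous_apply i).comp (contDiff_stdGen.continuous.comp continuous_coord)

theorem continuous_frame (s : Equiv.Perm (Fin (d + m))) :
    Continuous fun x : Config d m D => x.frame s :=
  continuous_matrix fun a j => (continuous_apply a).comp (continuous_gen (s (Fin.castAdd m j)))

/-- The space of arrows is a closed subspace of `X × X × 𝔖`. -/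
theorem isClosedEmbedding_total :
    @IsClosedEmbedding _ _ _ (@instTopologicalSpaceProd _ _ _ ⊥)
      fun a : Quiver.Total (Config d m D) => ((a.left, a.right), perm a.hom) := by
  let _ : TopologicalSpace (Equiv.Perm (Fin (d + m))) := ⊥
  have _ : DiscreteTopology (Equiv.Perm (Fin (d + m))) := ⟨rfl⟩
  refine ⟨⟨⟨?_⟩, fun a b hab => ?_⟩, ?_⟩
  · rw [instTopologicalSpaceProd, induced_inf, induced_compose, induced_compose]
    exact total_topology_eq
  · simp only [Prod.mk.injEq] at hab
    exact total_ext hab.1.1 hab.2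
  · have h : Set.range (fun a : Quiver.Total (Config d m D) => ((a.left, a.right), perm a.hom)) =
        ⋃ s : Equiv.Perm (Fin (d + m)), {p | ((∀ i, (p.1.1.frame s).mulVec (p.1.2.gen i) =
          p.1.1.gen (s i)) ∧ p.1.2.type = relabel s p.1.1.type) ∧ p.2 = s} := by
      ext ⟨⟨x, y⟩, s⟩
      simp only [Set.mem_range, Set.mem_iUnion, Set.mem_ofPred_eq, ← exists_hom_iff]
      constructor
      · rintro ⟨⟨x', y', f⟩, h⟩
        simp only [Prod.mk.injEq] at h
        obtain ⟨⟨rfl, rfl⟩, rfl⟩ := h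
        exact ⟨_, ⟨f, rfl⟩, rfl⟩
      · rintro ⟨s, ⟨f, rfl⟩, rfl⟩
        exact ⟨⟨x, y, f⟩, rfl⟩
    rw [h]
    refine isClosed_iUnion_of_finite fun s => ?_
    simp only [Set.ofPred_and, Set.ofPred_forall]
    refine ((isClosed_iInter fun i => isClosed_eq ?_ ?_).inter ?_).inter ?_
    · exact Continuous.matrix_mulVec ((continuous_frame s).comp (by fun_prop))
        ((continuous_gen i).comp (by fun_prop))
    · exact (continuous_gen (s i)).comp (by fun_prop)
    · have h1 : IsLocallyConstant fun p : (Config d m D × Config d m D) × Equiv.Perm (Fin (d + m)) =>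
          (p.1.2.type, relabel s p.1.1.type) :=
        (isLocallyConstant_type.comp_continuous (continuous_snd.comp continuous_fst)).prodMk
          ((isLocallyConstant_type.comp_continuous (continuous_fst.comp continuous_fst)).comp
            (relabel s))
      exact isOpen_compl_iff.1 (h1 {q | q.1 = q.2}ᶜ)
    · exact isClosed_eq continuous_snd continuous_const

instance : T2Space (Quiver.Total (Config d m D)) := by
  let _ : TopologicalSpace (Equiv.Perm (Fin (d + m))) := ⊥
  have _ : DiscreteTopology (Equiv.Perm (Fin (d + m))) := ⟨rfl⟩
  exact isClosedEmbedding_total.isEmbedding.t2Space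

instance : SecondCountableTopology (Quiver.Total (Config d m D)) := by
  let _ : TopologicalSpace (Equiv.Perm (Fin (d + m))) := ⊥
  have _ : DiscreteTopology (Equiv.Perm (Fin (d + m))) := ⟨rfl⟩
  exact isClosedEmbedding_total.isEmbedding.secondCountableTopology

/-- The finite discrete set of permutations is compact, so projecting it away is proper, and closed
embeddings are proper. -/
theorem isProperMap_left_right :
    IsProperMap fun a : Quiver.Total (Config d m D) => (a.left, a.right) := by
  let _ : TopologicalSpace (Equiv.Perm (Fin (d + m))) := ⊥
  have _ : DiscreteTopology (Equiv.Perm (Fin (d + m))) := ⟨rfl⟩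
  have h : IsProperMap (Prod.fst : (Config d m D × Config d m D) × Equiv.Perm (Fin (d + m)) → _) :=
    isProperMap_fst_of_compactSpace
  exact h.comp isClosedEmbedding_total.isProperMap

theorem continuous_comp :
    Continuous fun q : {q : Quiver.Total (Config d m D) × Quiver.Total (Config d m D) //
        q.1.right = q.2.left} =>
      (⟨q.1.1.left, q.1.2.right, q.1.1.hom ≫ eqToHom q.2 ≫ q.1.2.hom⟩ :
        Quiver.Total (Config d m D)) := by
  have h1 : Continuous fun q : {q : Quiver.Total (Config d m D) × Quiver.Total (Config d m D) //
        q.1.right = q.2.left} => q.1.1 := continuous_fst.comp continuous_subtype_val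
  have h2 : Continuous fun q : {q : Quiver.Total (Config d m D) × Quiver.Total (Config d m D) //
        q.1.right = q.2.left} => q.1.2 := continuous_snd.comp continuous_subtype_val
  refine continuous_total (continuous_left.comp h1 :) (continuous_right.comp h2 :) ?_
  simp only [perm_comp, perm_eqToHom, one_mul]
  exact (isLocallyConstant_perm.comp_continuous h1).mul (isLocallyConstant_perm.comp_continuous h2)

theorem continuous_inv :
    Continuous fun a : Quiver.Total (Config d m D) =>
      (⟨a.right, a.left, Groupoid.inv a.hom⟩ : Quiver.Total (Config d m D)) :=
  continuous_total continuous_right continuous_left isLocallyConstant_perm.inv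

theorem continuous_unit :
    Continuous fun x : Config d m D => (⟨x, x, 𝟙 x⟩ : Quiver.Total (Config d m D)) :=
  continuous_total continuous_id continuous_id (IsLocallyConstant.const 1)

/-- Inversion of arrows. -/
def invHomeomorph : Quiver.Total (Config d m D) ≃ₜ Quiver.Total (Config d m D) where
  toFun a := ⟨a.right, a.left, Groupoid.inv a.hom⟩
  invFun a := ⟨a.right, a.left, Groupoid.inv a.hom⟩
  left_inv a := total_ext rfl (inv_inv (perm a.hom))
  right_inv a := total_ext rfl (inv_inv (perm a.hom))
  continuous_toFun := continuous_inv
  continuous_invFun := continuous_inv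

theorem isLocalHomeomorph_right :
    IsLocalHomeomorph fun a : Quiver.Total (Config d m D) => a.right :=
  isLocalHomeomorph_left.comp (invHomeomorph (D := D)).isLocalHomeomorph

/-- The saturation of `U` is the image under the target map of the arrows with source in `U`, and
the target map is open. -/
theorem isOpenMap_orbitMk : IsOpenMap (OrbitSpace.mk : Config d m D → OrbitSpace (Config d m D)) := by
  intro U hU
  change IsOpen (OrbitSpace.mk ⁻¹' (OrbitSpace.mk '' U))
  convert isLocalHomeomorph_right.isOpenMap _ (hU.preimage continuous_left) using 1
  ext y
  constructor
  · rintro ⟨x, hx, hxy⟩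
    obtain ⟨e⟩ : IsIsomorphic x y := Quotient.exact hxy
    exact ⟨⟨x, y, e.hom⟩, hx, rfl⟩
  · rintro ⟨⟨x, y, f⟩, hx, rfl⟩
    exact ⟨x, hx, Quotient.sound ⟨Groupoid.isoEquivHom _ _ |>.symm f⟩⟩

theorem continuous_orbitMk : Continuous (OrbitSpace.mk : Config d m D → OrbitSpace (Config d m D)) :=
  continuous_coinduced_rng

/-- The coordinates of a configuration, as a point of a Euclidean space. -/
noncomputable def coordEquiv (d m : ℕ) :
    (Fin m → Fin d → ℝ) ≃L[ℝ] EuclideanSpace ℝ (Fin (d * m)) :=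
  ContinuousLinearEquiv.ofFinrankEq (by simp [Module.finrank_pi_fintype, mul_comm])

theorem isLocalHomeomorph_coordEquiv :
    IsLocalHomeomorph fun x : Config d m D => coordEquiv d m x.coord :=
  (coordEquiv d m).toHomeomorph.isLocalHomeomorph.comp isLocalHomeomorph_coord

theorem isLocalHomeomorph_coordEquiv_left :
    IsLocalHomeomorph fun a : Quiver.Total (Config d m D) => coordEquiv d m a.left.coord :=
  isLocalHomeomorph_coordEquiv.comp isLocalHomeomorph_left

noncomputable instance : ChartedSpace (EuclideanSpace ℝ (Fin (d * m))) (Config d m D) :=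
  chartedSpaceOfLocalHomeomorph isLocalHomeomorph_coordEquiv

noncomputable instance :
    ChartedSpace (EuclideanSpace ℝ (Fin (d * m))) (Quiver.Total (Config d m D)) :=
  chartedSpaceOfLocalHomeomorph isLocalHomeomorph_coordEquiv_left

instance : IsManifold (𝓡 (d * m)) ∞ (Config d m D) :=
  isManifold_of_localHomeomorph isLocalHomeomorph_coordEquiv

instance : IsManifold (𝓡 (d * m)) ∞ (Quiver.Total (Config d m D)) :=
  isManifold_of_localHomeomorph isLocalHomeomorph_coordEquiv_left

theorem isLocalDiffeomorph_coordEquiv : IsLocalDiffeomorph (𝓡 (d * m)) (𝓡 (d * m)) ∞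
    fun x : Config d m D => coordEquiv d m x.coord :=
  isLocalDiffeomorph_of_localHomeomorph isLocalHomeomorph_coordEquiv

theorem isLocalDiffeomorph_coordEquiv_left : IsLocalDiffeomorph (𝓡 (d * m)) (𝓡 (d * m)) ∞
    fun a : Quiver.Total (Config d m D) => coordEquiv d m a.left.coord :=
  isLocalDiffeomorph_of_localHomeomorph isLocalHomeomorph_coordEquiv_left

theorem isLocalDiffeomorph_coord : IsLocalDiffeomorph (𝓡 (d * m)) 𝓘(ℝ, Fin m → Fin d → ℝ) ∞
    (coord : Config d m D → _) := by
  intro x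
  have h := IsLocalDiffeomorphAt.comp 𝓘(ℝ, Fin m → Fin d → ℝ) _ (isLocalDiffeomorph_coordEquiv x)
    ((coordEquiv d m).symm.toDiffeomorph.isLocalDiffeomorph (coordEquiv d m x.coord))
  have h' : (coordEquiv d m).symm.toDiffeomorph ∘ (fun x : Config d m D => coordEquiv d m x.coord) =
      coord := funext fun x => (coordEquiv d m).symm_apply_apply x.coord
  rwa [h'] at h

/-- The charts on arrows are the coordinates of the source, so the source map is the identity in
charts. -/
theorem isLocalDiffeomorph_left : IsLocalDiffeomorph (𝓡 (d * m)) (𝓡 (d * m)) ∞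
    fun a : Quiver.Total (Config d m D) => a.left :=
  IsLocalDiffeomorph.of_comp isLocalDiffeomorph_coordEquiv isLocalHomeomorph_left
    isLocalDiffeomorph_coordEquiv_left

theorem contMDiff_unit : ContMDiff (𝓡 (d * m)) (𝓡 (d * m)) ∞
    fun x : Config d m D => (⟨x, x, 𝟙 x⟩ : Quiver.Total (Config d m D)) :=
  IsLocalDiffeomorph.contMDiff_of_comp isLocalDiffeomorph_coordEquiv_left continuous_unit
    isLocalDiffeomorph_coordEquiv.contMDiff

/-- The permutation is locally constant, so locally the target coordinates are one fixed `normCoord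
s` of the source coordinates. -/
theorem contMDiff_coord_right : ContMDiff (𝓡 (d * m)) 𝓘(ℝ, Fin m → Fin d → ℝ) ∞
    fun a : Quiver.Total (Config d m D) => a.right.coord := by
  intro a
  have h1 : ContMDiffAt (𝓡 (d * m)) 𝓘(ℝ, Fin m → Fin d → ℝ) ∞
      (fun a : Quiver.Total (Config d m D) => a.left.coord) a :=
    (isLocalDiffeomorph_coord.contMDiff.comp isLocalDiffeomorph_left.contMDiff) a
  have h2 : ContMDiffAt 𝓘(ℝ, Fin m → Fin d → ℝ) 𝓘(ℝ, Fin m → Fin d → ℝ) ∞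
      (normCoord (perm a.hom)) a.left.coord :=
    (contDiffAt_normCoord (perm a.hom) (Arrow.isUnit_det a.hom)).contMDiffAt
  refine (h2.comp a h1).congr_of_eventuallyEq ?_
  filter_upwards [isLocallyConstant_perm.eventually_eq a] with b hb
  rw [coord_eq_normCoord b.hom, hb]
  rfl

theorem contMDiff_inv : ContMDiff (𝓡 (d * m)) (𝓡 (d * m)) ∞
    fun a : Quiver.Total (Config d m D) =>
      (⟨a.right, a.left, Groupoid.inv a.hom⟩ : Quiver.Total (Config d m D)) :=
  IsLocalDiffeomorph.contMDiff_of_comp isLocalDiffeomorph_coordEquiv_left continuous_inv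
    ((coordEquiv d m).contDiff.contMDiff.comp contMDiff_coord_right)

theorem isLocalDiffeomorph_right : IsLocalDiffeomorph (𝓡 (d * m)) (𝓡 (d * m)) ∞
    fun a : Quiver.Total (Config d m D) => a.right := by
  let e : Diffeomorph (𝓡 (d * m)) (𝓡 (d * m)) (Quiver.Total (Config d m D))
      (Quiver.Total (Config d m D)) ∞ :=
    ⟨invHomeomorph.toEquiv, contMDiff_inv, contMDiff_inv⟩
  exact fun a => IsLocalDiffeomorphAt.comp _ _ (e.isLocalDiffeomorph a) (isLocalDiffeomorph_left (e a))

variable (d m D) in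
/-- The orbifold of configurations. -/
noncomputable def realOrbifold : RealOrbifold (Config d m D) (d * m) where
  source_localDiffeo := isLocalDiffeomorph_left
  target_localDiffeo := isLocalDiffeomorph_right
  unit_smooth := contMDiff_unit
  inv_smooth := contMDiff_inv
  comp_continuous := continuous_comp
  proper := isProperMap_left_right

end Config

/-! ### Isomorphisms of fans -/

variable {d n m : ℕ}

namespace QuantumFan

variable {F F' : QuantumFan d n}

/-- A linear map that permutes the generators and respects the combinatorial types is a morphism
of fans. -/
def homOfPerm (hc : F.IsGammaComplete) (hs : F.IsSimplicial) (s : Equiv.Perm (Fin n))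
    (L : (Fin d → ℝ) →ₗ[ℝ] Fin d → ℝ) (hL : ∀ i, L (F.gen (s i)) = F'.gen i)
    (hcomb : F'.comb = relabel s F.comb) : F ⟶ F' where
  toLin := L
  map_Γ := by
    have h : F.Γ ≤ F'.Γ.comap L.toAddMonoidHom := by
      rw [hc, AddSubgroup.closure_le]
      rintro _ ⟨i, rfl⟩
      obtain ⟨j, rfl⟩ := s.surjective i
      change L (F.gen (s j)) ∈ F'.Γ
      exact hL j ▸ F'.gen_mem j
    exact fun x hx => h hx
  map_cone := by
    rw [hs.cones_eq]
    rintro _ ⟨I, hI, rfl⟩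
    have hI' : I.map s.symm.toEmbedding ∈ F'.comb := by
      rw [hcomb]
      change Finset.map s.toEmbedding (Finset.map s.symm.toEmbedding I) ∈ F.comb
      rw [Finset.map_map]
      convert hI
      ext i
      simp
    refine ⟨_, hI', ?_⟩
    intro x hx
    obtain ⟨c, hc, hc', rfl⟩ := mem_hull_image_iff.1 hx
    rw [map_sum]
    refine Submodule.sum_mem _ fun i _ => ?_
    rw [map_smul]
    by_cases hi : i ∈ I
    · refine Submodule.smul_mem _ (⟨c i, hc i⟩ : {c : ℝ // 0 ≤ c})
        (Submodule.subset_span ⟨s.symm i, ?_, ?_⟩)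
      · simpa using hi
      · rw [← hL, s.apply_symm_apply]
    · rw [hc' i hi, zero_smul]
      exact Submodule.zero_mem _
  map_gen := fun i σ' _ h => by
    obtain ⟨j, rfl⟩ := s.surjective i
    exact AddSubmonoid.subset_closure ⟨h, j, hL j⟩

/-- A linear automorphism that permutes the generators and respects the combinatorial types is an
isomorphism of fans. -/
def isoOfPerm (hc : F.IsGammaComplete) (hs : F.IsSimplicial) (hc' : F'.IsGammaComplete)
    (hs' : F'.IsSimplicial) (s : Equiv.Perm (Fin n))
    (L : (Fin d → ℝ) ≃ₗ[ℝ] Fin d → ℝ) (hL : ∀ i, L (F.gen (s i)) = F'.gen i)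
    (hcomb : F'.comb = relabel s F.comb) : F ≅ F' where
  hom := homOfPerm hc hs s L hL hcomb
  inv := homOfPerm hc' hs' s⁻¹ L.symm
    (fun i => L.symm_apply_eq.2 <| by
      rw [← hL]
      exact congrArg (fun j => L (F.gen j)) (s.apply_symm_apply i))
    (by rw [hcomb, ← Config.relabel_mul, mul_inv_cancel, Config.relabel_one])
  hom_inv_id := Hom.ext (LinearMap.ext L.symm_apply_apply)
  inv_hom_id := Hom.ext (LinearMap.ext L.apply_symm_apply)

theorem span_range_gen (hc : F.IsGammaComplete) : Submodule.span ℝ (Set.range F.gen) = ⊤ := by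
  rw [eq_top_iff, ← F.span_eq_top, Submodule.span_le, hc]
  intro x hx
  have h : AddSubgroup.closure (Set.range F.gen) ≤
      (Submodule.span ℝ (Set.range F.gen)).toAddSubgroup :=
    (AddSubgroup.closure_le _).2 Submodule.subset_span
  exact h hx

theorem iso_hom_inv_apply (f : F ≅ F') (x : Fin d → ℝ) :
    Hom.toLin f.inv (Hom.toLin f.hom x) = x :=
  congrArg (fun g : F ⟶ F => Hom.toLin g x) f.hom_inv_id

theorem iso_injective (f : F ≅ F') : Function.Injective (Hom.toLin f.hom) :=
  Function.LeftInverse.injective (iso_hom_inv_apply f)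

/-- The image of `gen i` is an `ℕ`-combination of generators in some `σ'`. The inverse carries `σ'`
into a cone of which the ray of `gen i` is a face, so every nonzero summand is pulled back into that
ray. All of them thus lie on one ray and carry one label. -/
theorem iso_gen_eq_nsmul (f : F ≅ F') (i : Fin n) :
    ∃ (j : Fin n) (k : ℕ), Hom.toLin f.hom (F.gen i) = k • F'.gen j := by
  obtain ⟨σ', hσ', h⟩ := Hom.map_cone f.hom _ (F.ray_mem i)
  have hi : Hom.toLin f.hom (F.gen i) ∈ σ' := h _ (PointedCone.subset_hull (Set.mem_singleton _))
  obtain ⟨σ, hσ, h'⟩ := Hom.map_cone f.inv σ' hσ'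
  have hiσ : F.gen i ∈ σ := by simpa only [iso_hom_inv_apply] using h' _ hi
  have hface := F.ray_isFaceOf hσ hiσ
  have hle : ∀ x ∈ AddSubmonoid.closure {w | w ∈ σ' ∧ ∃ j, w = F'.gen j}, x ∈ σ' := by
    intro x hx
    have : AddSubmonoid.closure {w | w ∈ σ' ∧ ∃ j, w = F'.gen j} ≤ σ'.toAddSubmonoid :=
      AddSubmonoid.closure_le.2 fun w hw => hw.1
    exact this hx
  have key : ∀ x ∈ AddSubmonoid.closure {w | w ∈ σ' ∧ ∃ j, w = F'.gen j},
      Hom.toLin f.inv x ∈ PointedCone.hull ℝ {F.gen i} → x = 0 ∨ ∃ (j : Fin n) (k : ℕ),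
        x = k • F'.gen j ∧ Hom.toLin f.inv (F'.gen j) ∈ PointedCone.hull ℝ {F.gen i} := by
    intro x hx
    induction hx using AddSubmonoid.closure_induction with
    | mem x hx =>
      obtain ⟨-, j, rfl⟩ := hx
      exact fun hj => Or.inr ⟨j, 1, (one_smul _ _).symm, hj⟩
    | zero => exact fun _ => Or.inl rfl
    | add x y hx hy ihx ihy =>
      intro hxy
      rw [map_add] at hxy
      have hxσ := h' _ (hle x hx)
      have hyσ := h' _ (hle y hy)
      rcases ihx (hface.mem_of_add_mem_left hxσ hyσ hxy) with rfl | ⟨j, k, rfl, hj⟩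
      · simpa using ihy (hface.mem_of_add_mem_right hxσ hyσ hxy)
      rcases ihy (hface.mem_of_add_mem_right hxσ hyσ hxy) with rfl | ⟨j', k', rfl, hj'⟩
      · exact Or.inr ⟨j, k, by simp, hj⟩
      have hjj : j = j' := by
        have hne : Hom.toLin f.inv (F'.gen j') ≠ 0 := fun h0 =>
          F'.gen_ne_zero j' (iso_injective f.symm (h0.trans (map_zero _).symm))
        rw [← hull_singleton_eq_of_mem hne hj', mem_hull_singleton_iff] at hj
        obtain ⟨r, hr, hrj⟩ := hj
        refine F'.eq_of_gen_mem_hull (mem_hull_singleton_iff.2 ⟨r, hr, iso_injective f.symm ?_⟩)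
        exact (map_smul _ _ _).trans hrj
      subst hjj
      exact Or.inr ⟨j, k + k', (add_smul _ _ _).symm, hj⟩
  rcases key _ (Hom.map_gen f.hom i σ' hσ' hi) (by
    rw [iso_hom_inv_apply]
    exact Submodule.mem_span_singleton_self _) with h0 | ⟨j, k, hjk, -⟩
  -- This case cannot occur for an isomorphism, but multiplicity zero absorbs it.
  · exact ⟨i, 0, by rw [h0, zero_smul]⟩
  · exact ⟨j, k, hjk⟩

/-- Going forth and back multiplies `gen i` by a product `k * l` of natural numbers, which must be
`1`. -/
theorem iso_gen_eq (f : F ≅ F') (i : Fin n) : ∃ j, Hom.toLin f.hom (F.gen i) = F'.gen j := by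
  obtain ⟨j, k, hk⟩ := iso_gen_eq_nsmul f i
  obtain ⟨i', l, hl⟩ := iso_gen_eq_nsmul f.symm j
  have h : F.gen i = (k * l) • F.gen i' := by
    have := iso_hom_inv_apply f (F.gen i)
    rw [hk, map_nsmul] at this
    rw [← this, mul_smul, ← hl]
    rfl
  obtain rfl : i = i' := by
    refine F.eq_of_gen_mem_hull ?_
    rw [h]
    exact nsmul_mem (Submodule.mem_span_singleton_self _) _
  have hkl : k * l = 1 := by
    have h2 : ((k * l : ℕ) : ℝ) • F.gen i = (1 : ℝ) • F.gen i := by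
      rw [Nat.cast_smul_eq_nsmul, ← h, one_smul]
    exact_mod_cast smul_left_injective ℝ (F.gen_ne_zero i) h2
  obtain rfl := Nat.eq_one_of_mul_eq_one_right hkl
  exact ⟨j, by rw [hk, one_smul]⟩

/-- The image of the cone lies in the cone over some simplex `J` of `F'`. Its generators then have
labels in `J`, and a subset of a simplex is a simplex. -/
theorem map_mem_comb (hs' : F'.IsSimplicial) (f : F ⟶ F') (t : Equiv.Perm (Fin n))
    (ht : ∀ i, Hom.toLin f (F.gen i) = F'.gen (t i)) {I : Finset (Fin n)} (hI : I ∈ F.comb) :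
    I.map t.toEmbedding ∈ F'.comb := by
  obtain ⟨σ', hσ', h⟩ := Hom.map_cone f _ hI
  rw [hs'.cones_eq] at hσ'
  obtain ⟨J, hJ, rfl⟩ := hσ'
  refine hs'.isComplex.mem_of_subset J hJ _ fun j hj => ?_
  obtain ⟨i, hi, rfl⟩ := Finset.mem_map.1 hj
  refine F'.mem_of_gen_mem_hull hJ ?_
  have := h (F.gen i) (Submodule.subset_span ⟨i, hi, rfl⟩)
  rwa [ht] at this

/-- An isomorphism of simplicial fans permutes the generators. -/
theorem iso_exists_perm (hs : F.IsSimplicial) (hs' : F'.IsSimplicial) (f : F ≅ F') :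
    ∃ s : Equiv.Perm (Fin n), (∀ i, Hom.toLin f.hom (F.gen (s i)) = F'.gen i) ∧
      F'.comb = relabel s F.comb := by
  choose t ht using iso_gen_eq f
  have hinj : Function.Injective t := fun i j hij =>
    F.gen_injective (iso_injective f (by rw [ht, ht, hij]))
  let e : Equiv.Perm (Fin n) := Equiv.ofBijective t (Finite.injective_iff_bijective.1 hinj)
  have hes : ∀ i, Hom.toLin f.hom (F.gen (e.symm i)) = F'.gen i := fun i => by
    rw [ht]
    exact congrArg F'.gen (e.apply_symm_apply i)
  -- Arrows send labels of the target to labels of the source, hence the inverse of the map `t` on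
  -- generators.
  refine ⟨e.symm, hes, ?_⟩
  ext I
  constructor
  · refine map_mem_comb hs f.inv e.symm fun i => ?_
    rw [← hes, iso_hom_inv_apply]
  · intro hI
    have := map_mem_comb hs' f.hom e ht hI
    rw [Finset.map_map] at this
    convert this
    ext i
    simp

end QuantumFan

/-! ### The equivalence with the groupoid of fans -/

namespace Config

variable {D : Set (Finset (Fin (d + m)))}

/-- The standard fan of a configuration. -/
def fan (x : Config d m D) : QuantumFan d (d + m) :=
  fanOfConfig x.isComplex x.isFanConfig x.span_range_gen

theorem fan_isGammaComplete (x : Config d m D) : x.fan.IsGammaComplete := rfl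

theorem fan_isSimplicial (x : Config d m D) : x.fan.IsSimplicial := fanOfConfig_isSimplicial _ _ _

theorem fan_comb (x : Config d m D) : x.fan.comb = x.type := fanOfConfig_comb _ _ _

/-- The functor that sends a configuration to its standard fan. -/
noncomputable def toFanOfType (d m : ℕ) (D : Set (Finset (Fin (d + m)))) :
    Config d m D ⥤ FanOfType d D where
  obj x := ⟨x.fan, x.fan_isGammaComplete, x.fan_isSimplicial, x.fan_comb.symm ▸ x.1.2⟩
  map {x y} f := ObjectProperty.homMk (QuantumFan.homOfPerm x.fan_isGammaComplete
    x.fan_isSimplicial (perm f) (Matrix.mulVecLin (x.frame (perm f))⁻¹) (Arrow.map_gen f)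
    (by rw [fan_comb, fan_comb]; exact Arrow.type_eq f))
  map_id x := by
    refine ObjectProperty.hom_ext _ (QuantumFan.Hom.ext ?_)
    change Matrix.mulVecLin (x.frame 1)⁻¹ = LinearMap.id
    rw [frame_one, inv_one, Matrix.mulVecLin_one]
  map_comp {x y z} f g := by
    refine ObjectProperty.hom_ext _ (QuantumFan.Hom.ext ?_)
    change Matrix.mulVecLin (x.frame (perm f * perm g))⁻¹ =
      (Matrix.mulVecLin (y.frame (perm g))⁻¹).comp (Matrix.mulVecLin (x.frame (perm f))⁻¹)
    have h : x.frame (perm f) * y.frame (perm g) = x.frame (perm f * perm g) :=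
      Arrow.frame_mul' f (perm g)
    rw [← h, Matrix.mul_inv_rev, Matrix.mulVecLin_mul]

/-- The functor from configurations to the groupoid of fans and isomorphisms. -/
noncomputable def toCore (d m : ℕ) (D : Set (Finset (Fin (d + m)))) :
    Config d m D ⥤ Core (FanOfType d D) := Core.functorToCore (toFanOfType d m D)

theorem toCore_map_toLin {x y : Config d m D} (f : x ⟶ y) :
    ((toCore d m D).map f).iso.hom.hom.toLin = Matrix.mulVecLin (x.frame (perm f))⁻¹ := rfl

/-- The linear map is injective and the generators are distinct, so it determines the permutation.
-/
instance : (toCore d m D).Faithful where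
  map_injective {x y} f g h := by
    have h' : Matrix.mulVecLin (x.frame (perm f))⁻¹ = Matrix.mulVecLin (x.frame (perm g))⁻¹ := by
      rw [← toCore_map_toLin, h, toCore_map_toLin]
    refine perm_injective (Equiv.ext fun i => x.gen_injective
      (x.mulVecLin_inv_injective (Arrow.isUnit_det f) ?_))
    have hf : (x.frame (perm f))⁻¹.mulVecLin (x.gen (perm f i)) = y.gen i := Arrow.map_gen f i
    have hg : (x.frame (perm g))⁻¹.mulVecLin (x.gen (perm g i)) = y.gen i := Arrow.map_gen g i
    exact hf.trans (hg.symm.trans (LinearMap.congr_fun h'.symm _))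

instance : (toCore d m D).Full where
  map_surjective {x y} f := by
    let e : x.fan ≅ y.fan := (ObjectProperty.ι _).mapIso f.iso
    obtain ⟨s, hs, hcomb⟩ := QuantumFan.iso_exists_perm x.fan_isSimplicial y.fan_isSimplicial e
    rw [fan_comb, fan_comb] at hcomb
    -- Both fans are standard, so the linear map sends the first `d` columns `v_{s(j)}` to the
    -- canonical basis and must be the inverse of the frame.
    have hM : LinearMap.toMatrix' (QuantumFan.Hom.toLin e.hom) * x.frame s = 1 := by
      refine Matrix.ext_of_mulVec_single fun j => ?_
      rw [← Matrix.mulVec_mulVec, frame_mulVec_single, LinearMap.toMatrix'_mulVec,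
        Matrix.one_mulVec, ← y.gen_castAdd j]
      exact hs _
    have hinv : (x.frame s)⁻¹ = LinearMap.toMatrix' (QuantumFan.Hom.toLin e.hom) :=
      Matrix.inv_eq_left_inv hM
    have hdet : IsUnit (x.frame s).det :=
      (Matrix.isUnit_iff_isUnit_det _).1 (IsUnit.of_mul_eq_one_right _ hM)
    refine ⟨(⟨s, hdet, fun i => ?_, hcomb⟩ : Arrow x y), ?_⟩
    · rw [hinv, LinearMap.toMatrix'_mulVec]
      exact hs i
    · refine Core.hom_ext (ObjectProperty.hom_ext _ (QuantumFan.Hom.ext ?_))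
      change Matrix.mulVecLin (x.frame s)⁻¹ = QuantumFan.Hom.toLin e.hom
      rw [hinv, ← Matrix.toLin'_apply', Matrix.toLin'_toMatrix']

end Config

/-- An injection of the first labels extends to a permutation of all labels. -/
theorem exists_perm_castAdd {e : Fin d → Fin (d + m)} (he : Function.Injective e) :
    ∃ s : Equiv.Perm (Fin (d + m)), ∀ j, s (Fin.castAdd m j) = e j := by
  classical
  have hc : Function.Injective (Fin.castAdd m : Fin d → Fin (d + m)) := Fin.castAdd_injective d m
  let f : {i // i ∈ Set.range (Fin.castAdd m : Fin d → Fin (d + m))} ≃ {i // i ∈ Set.range e} :=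
    (Equiv.ofInjective _ hc).symm.trans (Equiv.ofInjective e he)
  refine ⟨f.extendSubtype, fun j => ?_⟩
  rw [Equiv.extendSubtype_apply_of_mem f _ ⟨j, rfl⟩]
  have : (Equiv.ofInjective _ hc).symm ⟨Fin.castAdd m j, ⟨j, rfl⟩⟩ = j :=
    Equiv.ofInjective_symm_apply hc j
  simp [f, this]

theorem isUnit_det_of_linearIndependent {v : Fin d → Fin d → ℝ} (hv : LinearIndependent ℝ v) :
    IsUnit (Matrix.of fun a j => v j a : Matrix (Fin d) (Fin d) ℝ).det :=
  (Matrix.isUnit_iff_isUnit_det _).1 (Matrix.linearIndependent_cols_iff_isUnit.1 hv)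

/-- Among vectors that span `ℝ^d`, some `d` form a basis. -/
theorem exists_perm_isUnit_det {v : Fin (d + m) → Fin d → ℝ}
    (hv : Submodule.span ℝ (Set.range v) = ⊤) : ∃ s : Equiv.Perm (Fin (d + m)),
      IsUnit (Matrix.of fun a j => v (s (Fin.castAdd m j)) a : Matrix (Fin d) (Fin d) ℝ).det := by
  obtain ⟨κ, a, ha, hspan, hli⟩ := exists_linearIndependent' ℝ v
  have := Finite.of_injective a ha
  have := Fintype.ofFinite κ
  have hcard : Fintype.card κ = d := by
    have := finrank_span_eq_card hli
    rw [hspan, hv, finrank_top, Module.finrank_fin_fun] at this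
    exact this.symm
  let e : Fin d ≃ κ := (Fintype.equivFinOfCardEq hcard).symm
  obtain ⟨s, hs⟩ := exists_perm_castAdd (m := m) (ha.comp e.injective)
  refine ⟨s, isUnit_det_of_linearIndependent (v := fun j => v (s (Fin.castAdd m j))) ?_⟩
  simp only [hs]
  exact hli.comp e e.injective

namespace Config

variable {D : Set (Finset (Fin (d + m)))}

/-- Every fan is isomorphic to a standard fan. -/
theorem exists_iso (F : FanOfType d D) :
    ∃ x : Config d m D, Nonempty (F ≅ (toFanOfType d m D).obj x) := by
  obtain ⟨hc, hs, hD⟩ := F.property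
  obtain ⟨s, hdet⟩ := exists_perm_isUnit_det (QuantumFan.span_range_gen hc)
  set A : Matrix (Fin d) (Fin d) ℝ := Matrix.of fun a j => F.obj.gen (s (Fin.castAdd m j)) a
  let L : (Fin d → ℝ) ≃ₗ[ℝ] Fin d → ℝ := LinearEquiv.ofLinearMap A⁻¹.mulVecLin A.mulVecLin
    (by rw [← Matrix.mulVecLin_mul, Matrix.nonsing_inv_mul _ hdet, Matrix.mulVecLin_one])
    (by rw [← Matrix.mulVecLin_mul, Matrix.mul_nonsing_inv _ hdet, Matrix.mulVecLin_one])
  let u : Fin m → Fin d → ℝ := fun i => L (F.obj.gen (s (Fin.natAdd d i)))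
  have hL : ∀ i, L (F.obj.gen (s i)) = stdGen u i := by
    intro i
    induction i using Fin.addCases with
    | left j =>
      rw [stdGen_castAdd, ← L.eq_symm_apply]
      exact (Matrix.mulVec_single_one A j).symm
    | right j => rw [stdGen_natAdd]
  -- The choice of a basis among the generators changes the type to `relabel s F.obj.comb`; this is
  -- why all types equivalent to `D` occur in the configuration space.
  have hu : IsRealizable (relabel s F.obj.comb) u := isRealizable_iff.2
    ⟨hs.isComplex.relabel s, hs.isFanConfig.relabel s L.toLinearMap L.injective hL⟩
  let x : Config d m D := mk (hD.relabel s) ⟨u, hu⟩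
  exact ⟨x, ⟨ObjectProperty.isoMk _ (QuantumFan.isoOfPerm hc hs x.fan_isGammaComplete
    x.fan_isSimplicial s L hL x.fan_comb)⟩⟩

instance : (toCore d m D).EssSurj where
  mem_essImage F := by
    obtain ⟨x, ⟨e⟩⟩ := exists_iso F.of
    exact ⟨x, ⟨Core.isoMk e.symm⟩⟩

instance : (toCore d m D).IsEquivalence where

/-! ### The orbit space and the moduli space -/

theorem iso_iff (x y : Config d m D) :
    Nonempty (x ≅ y) ↔ Nonempty ((toFanOfType d m D).obj x ≅ (toFanOfType d m D).obj y) := by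
  constructor
  · rintro ⟨e⟩
    exact ⟨(toFanOfType d m D).mapIso e⟩
  · rintro ⟨e⟩
    exact ⟨(toCore d m D).preimageIso (Core.isoMk e)⟩

/-- The map from the orbit space to the moduli space. -/
noncomputable def orbitToModuli (d m : ℕ) (D : Set (Finset (Fin (d + m)))) :
    OrbitSpace (Config d m D) → ModuliSpace d D :=
  Quotient.lift (fun x => ModuliSpace.mk ((toFanOfType d m D).obj x))
    fun x y h => Quotient.sound ((iso_iff x y).1 h)

theorem orbitToModuli_bijective : Function.Bijective (orbitToModuli d m D) := by
  constructor
  · rintro ⟨x⟩ ⟨y⟩ h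
    exact Quotient.sound ((iso_iff x y).2 (Quotient.exact h))
  · rintro ⟨F⟩
    obtain ⟨x, h⟩ := exists_iso F
    exact ⟨OrbitSpace.mk x, Quotient.sound (h.map Iso.symm)⟩

/-- The standard fan of a configuration, as a standard fan. -/
noncomputable def toStdFan (x : Config d m D) : StdFan d m D :=
  ⟨(toFanOfType d m D).obj x, x.coord, rfl⟩

/-- The configuration of a standard fan. -/
noncomputable def ofStdFan (F : StdFan d m D) : Config d m D :=
  mk F.1.property.2.2 ⟨F.2.choose, F.1.obj, F.2.choose_spec, F.1.property.1, F.1.property.2.1, rfl⟩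

theorem gen_ofStdFan (F : StdFan d m D) : (ofStdFan F).gen = F.1.obj.gen := F.2.choose_spec.symm

theorem type_ofStdFan (F : StdFan d m D) : (ofStdFan F).type = F.1.obj.comb := rfl

theorem orbitToModuli_ofStdFan (F : StdFan d m D) :
    orbitToModuli d m D (OrbitSpace.mk (ofStdFan F)) = ModuliSpace.mk F.1 := by
  refine Quotient.sound ⟨ObjectProperty.isoMk _ (QuantumFan.isoOfPerm
    (ofStdFan F).fan_isGammaComplete (ofStdFan F).fan_isSimplicial F.1.property.1 F.1.property.2.1 1
    (LinearEquiv.refl ℝ _) (fun i => congrFun (gen_ofStdFan F) i) ?_)⟩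
  rw [relabel_one]
  exact ((ofStdFan F).fan_comb.trans (type_ofStdFan F)).symm

theorem stdFan_topology_eq : (inferInstance : TopologicalSpace (StdFan d m D)) =
    TopologicalSpace.induced (fun F => F.1.obj.comb) ⊥ ⊓
      TopologicalSpace.induced (fun F => F.1.obj.gen) inferInstance := rfl

theorem continuous_toStdFan : Continuous (toStdFan : Config d m D → _) := by
  let _ : TopologicalSpace (Set (Finset (Fin (d + m)))) := ⊥
  refine continuous_inf_rng.2 ⟨continuous_induced_rng.2 ?_, continuous_induced_rng.2 ?_⟩
  · have h : IsLocallyConstant fun x : Config d m D => x.fan.comb := by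
      simpa only [fan_comb] using isLocallyConstant_type
    exact h.continuous
  · exact contDiff_stdGen.continuous.comp continuous_coord

theorem continuous_ofStdFan : Continuous (ofStdFan : StdFan d m D → _) := by
  let _ : TopologicalSpace (Set (Finset (Fin (d + m)))) := ⊥
  have _ : DiscreteTopology (Set (Finset (Fin (d + m)))) := ⟨rfl⟩
  have h1 : Continuous fun F : StdFan d m D => F.1.obj.comb :=
    continuous_iff_le_induced.2 (stdFan_topology_eq.trans_le inf_le_left)
  have h2 : Continuous fun F : StdFan d m D => F.1.obj.gen :=
    continuous_iff_le_induced.2 (stdFan_topology_eq.trans_le inf_le_right)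
  refine continuous_of_coord_type ?_ ((IsLocallyConstant.iff_continuous _).2 h1)
  refine continuous_pi fun i => ((continuous_apply (Fin.natAdd d i)).comp h2).congr fun F => ?_
  rw [Function.comp_apply, ← gen_ofStdFan]
  exact stdGen_natAdd _ i

/-- The orbit space of the groupoid of configurations is the moduli space. -/
noncomputable def orbitHomeomorph (d m : ℕ) (D : Set (Finset (Fin (d + m)))) :
    OrbitSpace (Config d m D) ≃ₜ ModuliSpace d D where
  toEquiv := Equiv.ofBijective _ (orbitToModuli_bijective (d := d) (m := m) (D := D))
  continuous_toFun := by
    -- Both sides carry quotient topologies; the continuous maps `toStdFan` and `ofStdFan` cover the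
    -- bijection and its inverse.
    refine continuous_coinduced_dom.2 ?_
    have h : Continuous fun F : StdFan d m D => ModuliSpace.mk F.1 := continuous_coinduced_rng
    exact h.comp continuous_toStdFan
  continuous_invFun := by
    refine continuous_coinduced_dom.2 ?_
    refine (continuous_orbitMk.comp (continuous_ofStdFan (D := D))).congr fun F => ?_
    exact ((Equiv.ofBijective _ orbitToModuli_bijective).symm_apply_eq.2
      (orbitToModuli_ofStdFan F).symm).symm

/-- The restriction of the quotient map to a component. -/
theorem isQuotientMap_orbitMk {D' : Set (Finset (Fin (d + m)))} (h : CombEquiv D D')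
    (hD' : Finset.univ.map (Fin.castAddEmb m) ∈ D') :
    Topology.IsQuotientMap fun u : {u : Fin m → Fin d → ℝ // IsRealizable D' u} =>
      OrbitSpace.mk (mk h u) := by
  refine IsOpenMap.isQuotientMap (isOpenMap_orbitMk.comp (isOpenEmbedding_mk h).isOpenMap)
    (continuous_orbitMk.comp (isOpenEmbedding_mk h).continuous) ?_
  rintro ⟨x⟩
  obtain ⟨s, hs⟩ : ∃ s, D' = relabel s x.type := by
    obtain ⟨a, ha⟩ := h
    obtain ⟨b, hb⟩ : CombEquiv D x.type := x.1.2
    refine ⟨b⁻¹ * a, ?_⟩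
    rw [hb, ← relabel_mul, mul_inv_cancel_left, ha]
  -- Since `s` carries the first `d` labels to a simplex of `x`, the corresponding generators are
  -- independent. Normalizing by `s` is then possible and lands in the component of `D'`.
  have hI : (Finset.univ.map (Fin.castAddEmb m)).map s.toEmbedding ∈ x.type := by
    rw [hs] at hD'
    exact hD'
  have hdet : IsUnit (x.frame s).det := by
    refine isUnit_det_of_linearIndependent (v := fun j => x.gen (s (Fin.castAdd m j))) ?_
    have hli := x.isFanConfig.linearIndepOn hI
    refine LinearIndependent.comp hli (fun j : Fin d => ⟨s (Fin.castAdd m j), by simp⟩) ?_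
    intro i j hij
    simpa using hij
  subst hs
  refine ⟨(x.normalize s hdet).2, Quotient.sound ?_⟩
  exact ⟨(Groupoid.isoEquivHom _ _ |>.symm (x.normalizeArrow s hdet)).symm⟩

end Config

/-- A fan has finitely many automorphisms. -/
theorem finite_aut {D : Set (Finset (Fin n))} (F : FanOfType d D) : Finite (Aut F) := by
  have h : ∀ f : Aut F, ∃ s : Equiv.Perm (Fin n),
      ∀ i, QuantumFan.Hom.toLin f.hom.hom (F.obj.gen (s i)) = F.obj.gen i := fun f =>
    (QuantumFan.iso_exists_perm F.property.2.1 F.property.2.1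
      ((ObjectProperty.ι _).mapIso f)).imp fun s hs => hs.1
  choose φ hφ using h
  -- The generators span, so an automorphism is determined by its permutation of them.
  refine Finite.of_injective φ fun f g hfg => Iso.ext (ObjectProperty.hom_ext _
    (QuantumFan.Hom.ext ?_))
  refine LinearMap.ext_on (QuantumFan.span_range_gen F.property.1) ?_
  rintro _ ⟨i, rfl⟩
  obtain ⟨j, rfl⟩ := (φ f).surjective i
  rw [hφ f, hfg, hφ g]

end QuantumToric

theorem mainTheorem8 (d m : ℕ) (D : Set (Finset (Fin (d + m))))
    (hD : ∃ F : QuantumToric.QuantumFan d (d + m),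
      F.IsGammaComplete ∧ F.IsSimplicial ∧ F.comb = D) :
    -- being realizable is an open condition
    (∀ D', QuantumToric.CombEquiv D D' →
      IsOpen {u : Fin m → Fin d → ℝ | QuantumToric.IsRealizable D' u}) ∧
    -- the groupoid of configurations and normalizations is a real orbifold of dimension `d * m`,
    -- smoothly coordinatized by the vectors of the configuration
    (∃ 𝒪 : QuantumToric.RealOrbifold (QuantumToric.Config d m D) (d * m),
      letI := 𝒪.chartedObj
      IsLocalDiffeomorph (𝓡 (d * m)) 𝓘(ℝ, Fin m → Fin d → ℝ) ∞
        (QuantumToric.Config.coord : QuantumToric.Config d m D → _)) ∧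
    -- it is equivalent to the groupoid of fans of type `D` and their isomorphisms, and its
    -- orbit space is the moduli space
    (∃ (Φ : QuantumToric.Config d m D ⥤ Core (QuantumToric.FanOfType d D))
      (h : QuantumToric.OrbitSpace (QuantumToric.Config d m D) ≃ₜ QuantumToric.ModuliSpace d D),
      Φ.IsEquivalence ∧
      (∀ x, (Φ.obj x).of.obj.gen = x.gen ∧ (Φ.obj x).of.obj.comb = x.type) ∧
      (∀ (x y : QuantumToric.Config d m D) (f : x ⟶ y),
        (Φ.map f).iso.hom.hom.toLin =
          Matrix.mulVecLin (x.frame (QuantumToric.Config.perm f))⁻¹) ∧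
      (∀ x, h (QuantumToric.OrbitSpace.mk x) = QuantumToric.ModuliSpace.mk (Φ.obj x).of)) ∧
    -- the isotropy groups are finite
    (∀ F : QuantumToric.FanOfType d D, Finite (Aut F)) ∧
    -- if the first `d` labels span a cone, a single component suffices
    (∀ (D' : Set (Finset (Fin (d + m)))) (h : QuantumToric.CombEquiv D D'),
      Finset.univ.map (Fin.castAddEmb m) ∈ D' →
      Topology.IsQuotientMap fun u : {u : Fin m → Fin d → ℝ // QuantumToric.IsRealizable D' u} =>
        QuantumToric.OrbitSpace.mk (QuantumToric.Config.mk h u)) := by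
  refine ⟨fun D' _ => QuantumToric.isOpen_isRealizable D',
    ⟨QuantumToric.Config.realOrbifold d m D, QuantumToric.Config.isLocalDiffeomorph_coord⟩,
    ⟨QuantumToric.Config.toCore d m D, QuantumToric.Config.orbitHomeomorph d m D, inferInstance,
      fun x => ⟨rfl, x.fan_comb⟩, fun _ _ f => QuantumToric.Config.toCore_map_toLin f,
      fun _ => rfl⟩,
    QuantumToric.finite_aut, fun _ h hD' => QuantumToric.Config.isQuotientMap_orbitMk h hD'⟩
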